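/- **Definitions.** All graphs are finite, simple, undirected, with at least one node. A *coalition structure* over a graph $G=(N,E)$ is a partition of $N$ into non-empty sets (coalitions); it is *connected* if each of its coalitions induces a connected subgraph of $G$. A function $v:2^N\to\mathbb{R}$ with $v(\emptyset)=0$ is *independent of disconnected members* (IDM) if $$v(C\cup\{i\})-v(C)=v(C\cup\{i,j\})-v(C\cup\{j\})$$ for all distinct non-adjacent nodes $i,j\in N$ and all $C\subseteq N\setminus\{i,j\}$. The *graph coalition structure generation* (GCSG) problem, given a connected graph $G$ and an IDM function $v$ (accessible through an oracle that returns $v(C)$ for a queried set $C$), is to find a connected coalition structure $\mathcal{C}$ that maximises $\sum_{C\in\mathcal{C}}v(C)$ over all coalition structures over $N$. A class $S$ of graphs (closed under isomorphism) *satisfies an $f(n)$-separator theorem with constant $\alpha$* if every $n$-node $G\in S$ has two subgraphs $A,B$ with $A\cup B=G$ such that $A\cap B$ has at most $f(n)$ nodes, and $A\setminus B$ and $B\setminus A$ each have at most $\alpha n$ nodes. Computation steps are those of programs (finite lists of mutually recursive first-order functions) on data built by pairing from natural and real numbers, where constants, variables, bindings, branches, pairing and unpairing, addition, subtraction and comparison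 of numbers, function calls and oracle queries each cost one step. **Proposition.** Let $S$ be a class of graphs that is closed under taking subgraphs. Suppose that for some constants $K,a,b>0$ every $n$-node graph in $S$ has at most $K\exp(a n^b)$ connected coalition structures. Suppose further that for some constants $L,c>0$ and $\alpha<1$ the class $S$ satisfies an $L n^c$-separator theorem with constant $\alpha$, and that there is a program which, without an oracle, finds (the node sets of) such a separator $A,B$ for every $n$-node $G\in S$ in $o\bigl(\exp(2aL^b n^{bc})\,n^{2cLn^c}\bigr)$ steps. 1. If $b\le 1$, then for every $\gamma>2Lc/(1-\alpha^c)$ there is a program that solves the GCSG problem over the connected $n$-node graphs in $S$ in $O\bigl(n^{\gamma n^c}\bigr)$ steps. 2. If $b>1$, then for every $\gamma>2aL^b/(1-\alpha^{bc})$ there is a program that solves the GCSG problem over the connected $n$-node graphs in $S$ in $O\bigl(\exp(\gamma n^{bc})\bigr)$ steps. -/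

import Mathlib

open Filter Asymptotics

namespace GCSG

/-! ### Coalition structures over graphs -/

section Coalitions

variable {V : Type} [Fintype V] [DecidableEq V]

/-- A coalition structure over `V` is a partition of `V` into non-empty coalitions. -/
abbrev CoalitionStructure (V : Type) [Fintype V] [DecidableEq V] : Type :=
  Finpartition (Finset.univ : Finset V)

/-- Every coalition induces a connected subgraph of `G`. -/
def IsConnectedCS (G : SimpleGraph V) (P : CoalitionStructure V) : Prop :=
  ∀ C ∈ P.parts, (G.induce (C : Set V)).Connected

/-- The total value of a coalition structure. -/
def totalValue (v : Finset V → ℝ) (P : CoalitionStructure V) : ℝ :=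
  ∑ C ∈ P.parts, v C

/-- Independence of disconnected members: two nodes `i`, `j` without a direct link (so that they
are separated by `C` in the subgraph induced by `C ∪ {i, j}`) do not affect each other's marginal
contribution to the coalition `C`. -/
def IsIDM (G : SimpleGraph V) (v : Finset V → ℝ) : Prop :=
  ∀ (i j : V) (C : Finset V), i ≠ j → ¬ G.Adj i j → i ∉ C → j ∉ C →
    v (insert i C) - v C = v (insert i (insert j C)) - v (insert j C)

/-- `P` solves the coalition structure generation problem over `G` with valuation `v`: its
coalitions are connected, and no coalition structure (connected or not) has a larger value. -/
def IsSolution (G : SimpleGraph V) (v : Finset V → ℝ) (P : CoalitionStructure V) : Prop :=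
  IsConnectedCS G P ∧ ∀ Q : CoalitionStructure V, totalValue v Q ≤ totalValue v P

/-- Two subgraphs that cover `G`, share at most `s` nodes, and such that each of them has at most
a fraction `α` of the nodes of `G` outside the other one. -/
def IsSeparation (G : SimpleGraph V) (s α : ℝ) (A B : G.Subgraph) : Prop :=
  A ⊔ B = ⊤ ∧ ((A.verts ∩ B.verts).ncard : ℝ) ≤ s ∧
    ((A.verts \ B.verts).ncard : ℝ) ≤ α * Fintype.card V ∧
    ((B.verts \ A.verts).ncard : ℝ) ≤ α * Fintype.card V

end Coalitions

/-! ### Classes of graphs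

A class of graphs is given by its members on the node sets `{0, …, n - 1}`; only graphs with at
least one node matter. -/

/-- A class of finite graphs, through its labelled members. -/
abbrev GraphClass : Type := (n : ℕ) → Set (SimpleGraph (Fin n))

/-- Closed under taking subgraphs: every graph isomorphic to a subgraph of a member is a member
(so the class does not depend on the labelling of the nodes). -/
def SubgraphClosed (S : GraphClass) : Prop :=
  ∀ (m n : ℕ) (H : SimpleGraph (Fin m)) (G : SimpleGraph (Fin n)),
    0 < m → G ∈ S n → H.IsContained G → H ∈ S m

/-- Every `n`-node member has at most `g n` connected coalition structures. -/
def ConnectedCSBound (S : GraphClass) (g : ℕ → ℝ) : Prop :=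
  ∀ (n : ℕ) (G : SimpleGraph (Fin n)), 0 < n → G ∈ S n →
    (Nat.card {P : CoalitionStructure (Fin n) // IsConnectedCS G P} : ℝ) ≤ g n

/-- The class satisfies an `f n`-separator theorem with constant `α`. -/
def SeparatorTheorem (S : GraphClass) (f : ℕ → ℝ) (α : ℝ) : Prop :=
  ∀ (n : ℕ) (G : SimpleGraph (Fin n)), 0 < n → G ∈ S n →
    ∃ A B : G.Subgraph, IsSeparation G (f n) α A B

/-! ### The model of computation

A program is a finite list of first-order, mutually recursive function definitions together with a
main expression. It works on data built by pairing from natural numbers and real numbers (stored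
exactly). One step is a single basic operation: reading a variable, a constant, a binding, a branch,
building or opening a pair, adding, subtracting or comparing two numbers, calling a function, or a
query to the oracle for the valuation function. There is no multiplication, and the only constants
are natural numbers. -/

/-- Data. -/
inductive Val : Type
  | nat (k : ℕ)
  | real (x : ℝ)
  | pair (a b : Val)

/-- Basic operations with one argument. -/
inductive UnOp : Type
  | fst
  | snd
  | isPair
  | toReal

/-- Basic operations with two arguments. -/
inductive BinOp : Type
  | pair
  | add
  | sub
  | le

/-- The result of a basic operation; `none` is a run-time error. -/
def UnOp.apply : UnOp → Val → Option Val
  | .fst, .pair a _ => some a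
  | .snd, .pair _ b => some b
  | .isPair, .pair _ _ => some (.nat 1)
  | .isPair, _ => some (.nat 0)
  | .toReal, .nat k => some (.real k)
  | _, _ => none

open Classical in
/-- The result of a basic operation; `none` is a run-time error. Subtraction of natural numbers is
truncated; comparisons return `1` or `0`. -/
noncomputable def BinOp.apply : BinOp → Val → Val → Option Val
  | .pair, a, b => some (.pair a b)
  | .add, .nat k, .nat l => some (.nat (k + l))
  | .add, .real x, .real y => some (.real (x + y))
  | .sub, .nat k, .nat l => some (.nat (k - l))
  | .sub, .real x, .real y => some (.real (x - y))
  | .le, .nat k, .nat l => some (.nat (if k ≤ l then 1 else 0))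
  | .le, .real x, .real y => some (.nat (if x ≤ y then 1 else 0))
  | _, _, _ => none

/-- Expressions. `var i` is the `i`-th most recently bound variable, `letIn e₁ e₂` binds the value
of `e₁` in `e₂`, `call f e` calls the `f`-th function of the program with argument `e`, and
`query e` asks the oracle for the value of the coalition denoted by `e`. -/
inductive Code : Type
  | var (i : ℕ)
  | lit (k : ℕ)
  | letIn (e₁ e₂ : Code)
  | ite (c e₁ e₂ : Code)
  | un (op : UnOp) (e : Code)
  | bin (op : BinOp) (e₁ e₂ : Code)
  | call (f : ℕ) (e : Code)
  | query (e : Code)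

/-- `Steps defs orc env e y t`: in a program with function bodies `defs`, with oracle `orc` and
values `env` of the variables, the evaluation of `e` terminates with value `y` after exactly `t`
steps. The body of a function sees its argument as its only variable. -/
inductive Steps (defs : List Code) (orc : Val → ℝ → Prop) :
    List Val → Code → Val → ℕ → Prop
  | var {env : List Val} {i : ℕ} {x : Val} (h : env[i]? = some x) :
      Steps defs orc env (.var i) x 1
  | lit {env : List Val} {k : ℕ} :
      Steps defs orc env (.lit k) (.nat k) 1
  | letIn {env : List Val} {e₁ e₂ : Code} {x y : Val} {t₁ t₂ : ℕ}
      (h₁ : Steps defs orc env e₁ x t₁) (h₂ : Steps defs orc (x :: env) e₂ y t₂) :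
      Steps defs orc env (.letIn e₁ e₂) y (t₁ + t₂ + 1)
  | iteTrue {env : List Val} {c e₁ e₂ : Code} {k : ℕ} {y : Val} {t₁ t₂ : ℕ}
      (h₁ : Steps defs orc env c (.nat (k + 1)) t₁) (h₂ : Steps defs orc env e₁ y t₂) :
      Steps defs orc env (.ite c e₁ e₂) y (t₁ + t₂ + 1)
  | iteFalse {env : List Val} {c e₁ e₂ : Code} {y : Val} {t₁ t₂ : ℕ}
      (h₁ : Steps defs orc env c (.nat 0) t₁) (h₂ : Steps defs orc env e₂ y t₂) :
      Steps defs orc env (.ite c e₁ e₂) y (t₁ + t₂ + 1)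
  | un {env : List Val} {op : UnOp} {e : Code} {x y : Val} {t : ℕ}
      (h : Steps defs orc env e x t) (hy : op.apply x = some y) :
      Steps defs orc env (.un op e) y (t + 1)
  | bin {env : List Val} {op : BinOp} {e₁ e₂ : Code} {x₁ x₂ y : Val} {t₁ t₂ : ℕ}
      (h₁ : Steps defs orc env e₁ x₁ t₁) (h₂ : Steps defs orc env e₂ x₂ t₂)
      (hy : op.apply x₁ x₂ = some y) :
      Steps defs orc env (.bin op e₁ e₂) y (t₁ + t₂ + 1)
  | call {env : List Val} {f : ℕ} {e body : Code} {x y : Val} {t₁ t₂ : ℕ}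
      (h₁ : Steps defs orc env e x t₁) (hf : defs[f]? = some body)
      (h₂ : Steps defs orc [x] body y t₂) :
      Steps defs orc env (.call f e) y (t₁ + t₂ + 1)
  | query {env : List Val} {e : Code} {x : Val} {r : ℝ} {t : ℕ}
      (h : Steps defs orc env e x t) (hr : orc x r) :
      Steps defs orc env (.query e) (.real r) (t + 1)

/-- A program. -/
structure Program : Type where
  /-- the bodies of the functions -/
  defs : List Code
  /-- the main expression; its only variable is the input -/
  main : Code

/-- On input `x` and with oracle `orc`, the program halts with output `y` after `t` steps. -/
def Program.Run (p : Program) (orc : Val → ℝ → Prop) (x y : Val) (t : ℕ) : Prop :=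
  Steps p.defs orc [x] p.main y t

/-! ### Encodings -/

/-- A list, as nested pairs ended by `0`. -/
def encList : List Val → Val
  | [] => .nat 0
  | x :: l => .pair x (encList l)

open Classical in
/-- A set of nodes, as the list of its indicator values. -/
noncomputable def encSet {n : ℕ} (X : Set (Fin n)) : Val :=
  encList (List.ofFn fun i : Fin n => Val.nat (if i ∈ X then 1 else 0))

/-- A graph, as its number of nodes and its adjacency matrix. -/
noncomputable def encGraph {n : ℕ} (G : SimpleGraph (Fin n)) : Val :=
  .pair (.nat n) (encList (List.ofFn fun i : Fin n => encSet (G.neighborSet i)))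

/-- `y` is a list of the coalitions of `P`, in some order and without repetition. -/
def EncodesCS {n : ℕ} (P : CoalitionStructure (Fin n)) (y : Val) : Prop :=
  ∃ l : List (Finset (Fin n)), l.Nodup ∧ l.toFinset = P.parts ∧
    y = encList (l.map fun C => encSet (C : Set (Fin n)))

/-- The oracle for a valuation function: it answers a set of nodes by its value. -/
def valuationOracle {n : ℕ} (v : Finset (Fin n) → ℝ) : Val → ℝ → Prop :=
  fun x r => ∃ C : Finset (Fin n), encSet (C : Set (Fin n)) = x ∧ v C = r

/-- No oracle: every query is a run-time error. -/
def noOracle : Val → ℝ → Prop := fun _ _ => False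

/-! ### Running times -/

/-- Separators of size at most `f n` with constant `α` are found for the `n`-node members of `S`
in `o(T n)` steps, by one program, which gets the graph and returns the node sets of the two
subgraphs. -/
def SeparatorFoundInLittleO (S : GraphClass) (f : ℕ → ℝ) (α : ℝ) (T : ℕ → ℝ) : Prop :=
  ∃ (p : Program) (t : ℕ → ℕ), (fun n => (t n : ℝ)) =o[atTop] T ∧
    ∀ (n : ℕ) (G : SimpleGraph (Fin n)), 0 < n → G ∈ S n →
      ∃ (A B : G.Subgraph) (k : ℕ), k ≤ t n ∧ IsSeparation G (f n) α A B ∧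
        p.Run noOracle (encGraph G) (.pair (encSet A.verts) (encSet B.verts)) k

/-- The graph coalition structure generation problem over the connected `n`-node members of `S` is
solved in `O(T n)` steps, by one program, for all valuation functions that are independent of
disconnected members. -/
def SolvedInBigO (S : GraphClass) (T : ℕ → ℝ) : Prop :=
  ∃ (p : Program) (t : ℕ → ℕ), (fun n => (t n : ℝ)) =O[atTop] T ∧
    ∀ (n : ℕ) (G : SimpleGraph (Fin n)), G ∈ S n → G.Connected →
      ∀ v : Finset (Fin n) → ℝ, v ∅ = 0 → IsIDM G v →
        ∃ (P : CoalitionStructure (Fin n)) (y : Val) (k : ℕ), k ≤ t n ∧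
          IsSolution G v P ∧ EncodesCS P y ∧ p.Run (valuationOracle v) (encGraph G) y k

end GCSG

/-! A coalition structure is represented by labelling the nodes with nodes; its value is the sum of
`v` over the label classes (`labValue`). Independence of disconnected members makes `v` modular
across a vertex cut: if no edge joins `X` to `Z`, then `v (C ∪ X ∪ Z) + v C = v (C ∪ X) + v (C ∪ Z)`
(`IsIDM.union_add`). Hence, once a separator is labelled, the best completions on its two sides can
be found independently and glued (`labValue_add`, `IsBest.merge`). This is the divide and conquer:
separate the graph induced by the open nodes, try labels on the separator, recurse on both sides
(`solve_spec`).

The search ignores connectedness. At the end every class is split into its connected components; by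
`IsIDM.eq_sum` this keeps the total value, so the result is connected and still optimal among all
coalition structures (`isSolution_fiberPartition`).

The names of labels are irrelevant, so a separator node only needs to try the labels in use and its
own name (`exists_relabel`). Separator sizes along a branch of the recursion are dominated by a
geometric series with sum `L n^c / (1 - α^c)` (`boundarySize`). This bounds both the number of
labels in use and the number of nodes labelled along a branch, so a node has at most `Q = O(n^c)`
options (`branching`). The separator finder on `r ≤ n` nodes costs at most a constant times `exp (A
n^(bc)) (r^c)^(2 L r^c)` with `A = 2 a L^b`, and its second factor is at most `Q` to the power of
twice the boundary size. The whole search thus takes a polynomial times `exp (A n^(bc)) Q^(2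
boundarySize)` steps (`searchCost_step`, `totalCost_le`). The logarithm of this is `A n^(bc) + 2 L c
/ (1 - α^c) n^c log n + O(n^c)`. For `b ≤ 1` the term with `n^c log n` dominates; for `b > 1` the
term `A n^(bc)` does, and `A ≤ A / (1 - α^(bc))`.

The program is written out in full. Since runs are deterministic, values and costs are functions of
the argument that can be computed by rewriting; loops are handled by an invariant on value and cost
together (`loop_inv`). -/

namespace GCSG

/-! ### Functional semantics of programs -/

section Semantics

/-- An oracle that gives at most one answer to every query. -/
def OracleDet (orc : Val → ℝ → Prop) : Prop := ∀ x r r', orc x r → orc x r' → r = r'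

/-- Only one rule applies to an expression once the values of its parts are known. This is what
allows values and step counts to be treated as functions. -/
theorem Steps.det {D : List Code} {orc : Val → ℝ → Prop} (ho : OracleDet orc)
    {env : List Val} {e : Code} {y : Val} {t : ℕ} (h : Steps D orc env e y t) :
    ∀ {y' : Val} {t' : ℕ}, Steps D orc env e y' t' → y = y' ∧ t = t' := by
  induction h with
  | var h => intro y' t' h'; cases h' with | var h' => simp_all
  | lit => intro y' t' h'; cases h'; simp
  | letIn h₁ h₂ ih₁ ih₂ =>
    intro y' t' h'
    cases h' with
    | letIn g₁ g₂ =>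
      obtain ⟨rfl, rfl⟩ := ih₁ g₁
      obtain ⟨rfl, rfl⟩ := ih₂ g₂
      simp
  | iteTrue h₁ h₂ ih₁ ih₂ =>
    intro y' t' h'
    cases h' with
    | iteTrue g₁ g₂ =>
      obtain ⟨_, rfl⟩ := ih₁ g₁
      obtain ⟨rfl, rfl⟩ := ih₂ g₂
      simp
    | iteFalse g₁ g₂ => obtain ⟨h, _⟩ := ih₁ g₁; simp at h
  | iteFalse h₁ h₂ ih₁ ih₂ =>
    intro y' t' h'
    cases h' with
    | iteFalse g₁ g₂ =>
      obtain ⟨_, rfl⟩ := ih₁ g₁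
      obtain ⟨rfl, rfl⟩ := ih₂ g₂
      simp
    | iteTrue g₁ g₂ => obtain ⟨h, _⟩ := ih₁ g₁; simp at h
  | un h hy ih =>
    intro y' t' h'
    cases h' with
    | un g gy => obtain ⟨rfl, rfl⟩ := ih g; simp_all
  | bin h₁ h₂ hy ih₁ ih₂ =>
    intro y' t' h'
    cases h' with
    | bin g₁ g₂ gy =>
      obtain ⟨rfl, rfl⟩ := ih₁ g₁
      obtain ⟨rfl, rfl⟩ := ih₂ g₂
      simp_all
  | call h₁ hf h₂ ih₁ ih₂ =>
    intro y' t' h'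
    cases h' with
    | call g₁ gf g₂ =>
      obtain ⟨rfl, rfl⟩ := ih₁ g₁
      rw [hf] at gf
      cases gf
      obtain ⟨rfl, rfl⟩ := ih₂ g₂
      simp
  | query h hr ih =>
    intro y' t' h'
    cases h' with
    | query g gr =>
      obtain ⟨rfl, rfl⟩ := ih g
      simp [ho _ _ _ hr gr]

/-- A run is not affected by further functions and by an oracle with more answers. -/
theorem Steps.mono {D D' : List Code} {orc orc' : Val → ℝ → Prop}
    (hD : ∀ (f : ℕ) (body : Code), D[f]? = some body → D'[f]? = some body)
    (ho : ∀ x r, orc x r → orc' x r)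
    {env : List Val} {e : Code} {y : Val} {t : ℕ} (h : Steps D orc env e y t) :
    Steps D' orc' env e y t := by
  induction h with
  | var h => exact .var h
  | lit => exact .lit
  | letIn _ _ ih₁ ih₂ => exact .letIn ih₁ ih₂
  | iteTrue _ _ ih₁ ih₂ => exact .iteTrue ih₁ ih₂
  | iteFalse _ _ ih₁ ih₂ => exact .iteFalse ih₁ ih₂
  | un _ hy ih => exact .un ih hy
  | bin _ _ hy ih₁ ih₂ => exact .bin ih₁ ih₂ hy
  | call _ hf _ ih₁ ih₂ => exact .call ih₁ (hD _ _ hf) ih₂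
  | query _ hr ih => exact .query ih (ho _ _ hr)

variable (D : List Code) (orc : Val → ℝ → Prop)

open Classical in
/-- The value of the `f`-th function. -/
noncomputable def valF (f : ℕ) (x : Val) : Option Val :=
  if h : ∃ y t body, D[f]? = some body ∧ Steps D orc [x] body y t then some h.choose else none

open Classical in
/-- The number of steps of the `f`-th function. -/
noncomputable def costF (f : ℕ) (x : Val) : ℕ :=
  if h : ∃ t y body, D[f]? = some body ∧ Steps D orc [x] body y t then h.choose else 0

open Classical in
/-- The answer of the oracle. -/
noncomputable def orcF (x : Val) : Option Val :=
  if h : ∃ r, orc x r then some (.real h.choose) else none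

/-- A branch on the value of the condition. -/
def branchOn {β : Type} (z : β) (x : Val) (a b : β) : β :=
  match x with
  | .nat 0 => b
  | .nat (_ + 1) => a
  | _ => z

/-- The value of an expression. -/
noncomputable def evalV : List Val → Code → Option Val
  | env, .var i => env[i]?
  | _, .lit k => some (.nat k)
  | env, .letIn a b => (evalV env a).bind fun x => evalV (x :: env) b
  | env, .ite c a b => (evalV env c).bind fun x => branchOn none x (evalV env a) (evalV env b)
  | env, .un op a => (evalV env a).bind op.apply
  | env, .bin op a b => (evalV env a).bind fun x => (evalV env b).bind fun y => op.apply x y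
  | env, .call f a => (evalV env a).bind (valF D orc f)
  | env, .query a => (evalV env a).bind (orcF orc)

/-- The number of steps of the evaluation of an expression. -/
noncomputable def evalT : List Val → Code → ℕ
  | _, .var _ => 1
  | _, .lit _ => 1
  | env, .letIn a b => evalT env a + ((evalV D orc env a).elim 0 fun x => evalT (x :: env) b) + 1
  | env, .ite c a b => evalT env c +
      ((evalV D orc env c).elim 0 fun x => branchOn 0 x (evalT env a) (evalT env b)) + 1
  | env, .un _ a => evalT env a + 1
  | env, .bin _ a b => evalT env a + evalT env b + 1
  | env, .call f a => evalT env a + ((evalV D orc env a).elim 0 (costF D orc f)) + 1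
  | env, .query a => evalT env a + 1

variable {D orc}

/-- `valF` and `costF` are chosen separately; determinism forces both choices to belong to the same
run. -/
theorem steps_of_valF (ho : OracleDet orc) {f : ℕ} {x y : Val} (h : valF D orc f x = some y) :
    ∃ body, D[f]? = some body ∧ Steps D orc [x] body y (costF D orc f x) := by
  unfold valF at h
  split_ifs at h with h'
  obtain ⟨t, body, hb, hs⟩ := h'.choose_spec
  rw [Option.some.inj h] at hs
  refine ⟨body, hb, ?_⟩
  have h2 : ∃ t y body, D[f]? = some body ∧ Steps D orc [x] body y t := ⟨_, _, _, hb, hs⟩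
  unfold costF
  rw [dif_pos h2]
  obtain ⟨y', body', hb', hs'⟩ := h2.choose_spec
  rw [hb] at hb'
  cases hb'
  obtain ⟨rfl, ht⟩ := hs.det ho hs'
  exact hs'

theorem steps_of_evalV (ho : OracleDet orc) {e : Code} :
    ∀ {env : List Val} {y : Val}, evalV D orc env e = some y →
      Steps D orc env e y (evalT D orc env e) := by
  induction e with
  | var i => intro env y h; exact .var h
  | lit k => intro env y h; simp only [evalV, Option.some.injEq] at h; subst h; exact .lit
  | letIn a b iha ihb =>
    intro env y h
    simp only [evalV, Option.bind_eq_some_iff] at h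
    obtain ⟨x, hx, hy⟩ := h
    simp only [evalT, hx, Option.elim]
    exact .letIn (iha hx) (ihb hy)
  | ite c a b ihc iha ihb =>
    intro env y h
    simp only [evalV, Option.bind_eq_some_iff] at h
    obtain ⟨x, hx, hy⟩ := h
    simp only [evalT, hx, Option.elim]
    match x, hx, hy with
    | .nat 0, hx, hy => exact .iteFalse (ihc hx) (ihb hy)
    | .nat (k + 1), hx, hy => exact .iteTrue (ihc hx) (iha hy)
  | un op a iha =>
    intro env y h
    simp only [evalV, Option.bind_eq_some_iff] at h
    obtain ⟨x, hx, hy⟩ := h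
    exact .un (iha hx) hy
  | bin op a b iha ihb =>
    intro env y h
    simp only [evalV, Option.bind_eq_some_iff] at h
    obtain ⟨x, hx, z, hz, hy⟩ := h
    exact .bin (iha hx) (ihb hz) hy
  | call f a iha =>
    intro env y h
    simp only [evalV, Option.bind_eq_some_iff] at h
    obtain ⟨x, hx, hy⟩ := h
    obtain ⟨body, hb, hs⟩ := steps_of_valF ho hy
    simp only [evalT, hx, Option.elim]
    exact .call (iha hx) hb hs
  | query a iha =>
    intro env y h
    simp only [evalV, Option.bind_eq_some_iff] at h
    obtain ⟨x, hx, hy⟩ := h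
    unfold orcF at hy
    split_ifs at hy with h'
    cases hy
    exact .query (iha hx) h'.choose_spec

theorem valF_costF_of_steps (ho : OracleDet orc) {f : ℕ} {body : Code} {x y : Val} {t : ℕ}
    (hf : D[f]? = some body) (h : Steps D orc [x] body y t) :
    valF D orc f x = some y ∧ costF D orc f x = t := by
  have h1 : ∃ y t body, D[f]? = some body ∧ Steps D orc [x] body y t := ⟨_, _, _, hf, h⟩
  have h2 : valF D orc f x = some y := by
    unfold valF
    rw [dif_pos h1]
    obtain ⟨t', body', hb', hs'⟩ := h1.choose_spec
    rw [hf] at hb'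
    cases hb'
    exact congrArg some (h.det ho hs').1.symm
  refine ⟨h2, ?_⟩
  obtain ⟨body', hb', hs'⟩ := steps_of_valF ho h2
  rw [hf] at hb'
  cases hb'
  exact (hs'.det ho h).2

/-- The working rule for verification: evaluating the body by rewriting yields the value and the
exact cost of a call, with no derivation of `Steps` to exhibit. -/
theorem valF_costF_of_evalV (ho : OracleDet orc) {f : ℕ} {body : Code} {x y : Val}
    (hf : D[f]? = some body) (h : evalV D orc [x] body = some y) :
    valF D orc f x = some y ∧ costF D orc f x = evalT D orc [x] body :=
  valF_costF_of_steps ho hf (steps_of_evalV ho h)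

theorem orcF_eq (ho : OracleDet orc) {x : Val} {r : ℝ} (h : orc x r) :
    orcF orc x = some (.real r) := by
  have h' : ∃ r, orc x r := ⟨r, h⟩
  unfold orcF
  rw [dif_pos h', ho _ _ _ h'.choose_spec h]

@[simp] theorem branchOn_ite {β : Type} (z : β) (q : Prop) [Decidable q] (a b : β) :
    branchOn z (.nat (if q then 1 else 0)) a b = if q then a else b := by
  split_ifs <;> rfl

@[simp] theorem branchOn_zero {β : Type} (z a b : β) : branchOn z (.nat 0) a b = b := rfl

@[simp] theorem branchOn_one {β : Type} (z a b : β) : branchOn z (.nat 1) a b = a := rfl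

@[simp] theorem apply_fst (x y : Val) : UnOp.fst.apply (.pair x y) = some x := rfl

@[simp] theorem apply_snd (x y : Val) : UnOp.snd.apply (.pair x y) = some y := rfl

@[simp] theorem apply_isPair (x y : Val) : UnOp.isPair.apply (.pair x y) = some (.nat 1) := rfl

@[simp] theorem apply_isPair_nat (k : ℕ) : UnOp.isPair.apply (.nat k) = some (.nat 0) := rfl

@[simp] theorem apply_toReal (k : ℕ) : UnOp.toReal.apply (.nat k) = some (.real k) := rfl

@[simp] theorem apply_pair (x y : Val) : BinOp.pair.apply x y = some (.pair x y) := rfl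

@[simp] theorem apply_add (k l : ℕ) : BinOp.add.apply (.nat k) (.nat l) = some (.nat (k + l)) := rfl

@[simp] theorem apply_add_real (x y : ℝ) :
    BinOp.add.apply (.real x) (.real y) = some (.real (x + y)) := rfl

@[simp] theorem apply_sub (k l : ℕ) : BinOp.sub.apply (.nat k) (.nat l) = some (.nat (k - l)) := rfl

open Classical in
@[simp] theorem apply_le (k l : ℕ) :
    BinOp.le.apply (.nat k) (.nat l) = some (.nat (if k ≤ l then 1 else 0)) := rfl

open Classical in
@[simp] theorem apply_le_real (x y : ℝ) :
    BinOp.le.apply (.real x) (.real y) = some (.nat (if x ≤ y then 1 else 0)) := rfl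

end Semantics

/-! ### Program fragments -/

section Fragments

/-- First component. -/
abbrev Code.fst (e : Code) : Code := .un .fst e

/-- Second component. -/
abbrev Code.snd (e : Code) : Code := .un .snd e

/-- Pairing. -/
abbrev Code.mk (e₁ e₂ : Code) : Code := .bin .pair e₁ e₂

/-- Test for equality of two natural numbers. -/
def Code.eq (e₁ e₂ : Code) : Code :=
  .bin .sub (.lit 1) (.bin .add (.bin .sub e₁ e₂) (.bin .sub e₂ e₁))

/-- Equality test on data. -/
def eqV (x y : Val) : Option Val :=
  match x, y with
  | .nat k, .nat l => some (.nat (if k = l then 1 else 0))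
  | _, _ => none

@[simp] theorem eqV_nat (k l : ℕ) : eqV (.nat k) (.nat l) = some (.nat (if k = l then 1 else 0)) :=
  rfl

variable {D : List Code} {orc : Val → ℝ → Prop}

/-- Subtraction is truncated, so `(k - l) + (l - k)` vanishes exactly for `k = l`; subtracting it
from `1` gives the truth value. -/
theorem evalV_eq (env : List Val) (e₁ e₂ : Code) {k l : ℕ}
    (h₁ : evalV D orc env e₁ = some (.nat k)) (h₂ : evalV D orc env e₂ = some (.nat l)) :
    evalV D orc env (.eq e₁ e₂) = some (.nat (if k = l then 1 else 0)) := by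
  simp only [Code.eq, evalV, h₁, h₂, Option.bind_some, apply_sub, apply_add, Option.some.injEq,
    Val.nat.injEq]
  split_ifs <;> omega

theorem evalT_eq (env : List Val) (e₁ e₂ : Code) :
    evalT D orc env (.eq e₁ e₂) = 2 * (evalT D orc env e₁ + evalT D orc env e₂) + 5 := by
  simp only [Code.eq, evalT]
  omega

/-- Body of a function that computes by recursion on the first component of its argument: `base`
sees the argument, `step` sees the value for the predecessor and the argument. -/
def loopBody (s : ℕ) (base step : Code) : Code :=
  .ite (.bin .le (.lit 1) (.fst (.var 0)))
    (.letIn (.call s (.mk (.bin .sub (.fst (.var 0)) (.lit 1)) (.snd (.var 0)))) step) base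

/-- A Hoare rule by induction on the counter. The invariant sees the accumulated cost, so
correctness and running time come from one induction. The control code takes 14 steps in a round and
5 steps around `base`. -/
theorem loop_inv (ho : OracleDet orc) {s : ℕ} {base step : Code}
    (hf : D[s]? = some (loopBody s base step)) (n : ℕ) (ctx : Val) (P : ℕ → Val → ℕ → Prop)
    (h0 : ∃ x, evalV D orc [.pair (.nat 0) ctx] base = some x ∧
      P 0 x (evalT D orc [.pair (.nat 0) ctx] base + 5))
    (hs : ∀ i < n, ∀ x t, P i x t →
      ∃ y, evalV D orc [x, .pair (.nat (i + 1)) ctx] step = some y ∧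
        P (i + 1) y (t + evalT D orc [x, .pair (.nat (i + 1)) ctx] step + 14)) :
    ∃ y, valF D orc s (.pair (.nat n) ctx) = some y ∧
      P n y (costF D orc s (.pair (.nat n) ctx)) := by
  have key : ∀ i ≤ n, ∃ y, valF D orc s (.pair (.nat i) ctx) = some y ∧
      P i y (costF D orc s (.pair (.nat i) ctx)) := by
    intro i
    induction i with
    | zero =>
      intro _
      obtain ⟨x, hx, hP⟩ := h0
      obtain ⟨h1, h2⟩ := valF_costF_of_evalV (x := .pair (.nat 0) ctx) (y := x) ho hf
        (by simp [loopBody, evalV, hx])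
      refine ⟨x, h1, ?_⟩
      rw [h2]
      convert hP using 1
      simp [loopBody, evalT, evalV]
      omega
    | succ i ih =>
      intro hi
      obtain ⟨x, hx, hP⟩ := ih (by omega)
      obtain ⟨y, hy, hP'⟩ := hs i (by omega) x _ hP
      obtain ⟨h1, h2⟩ := valF_costF_of_evalV (x := .pair (.nat (i + 1)) ctx) (y := y) ho hf
        (by simp [loopBody, evalV, hx, hy])
      refine ⟨y, h1, ?_⟩
      rw [h2]
      convert hP' using 1
      simp [loopBody, evalT, evalV, hx]
      omega
  exact key n le_rfl

theorem loop_eq (ho : OracleDet orc) {s : ℕ} {base step : Code}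
    (hf : D[s]? = some (loopBody s base step)) (n : ℕ) (ctx : Val) (acc : ℕ → Val) (B B₀ : ℕ)
    (h0 : evalV D orc [.pair (.nat 0) ctx] base = some (acc 0))
    (t0 : evalT D orc [.pair (.nat 0) ctx] base ≤ B₀)
    (hs : ∀ i < n, evalV D orc [acc i, .pair (.nat (i + 1)) ctx] step = some (acc (i + 1)))
    (ts : ∀ i < n, evalT D orc [acc i, .pair (.nat (i + 1)) ctx] step ≤ B) :
    valF D orc s (.pair (.nat n) ctx) = some (acc n) ∧
      costF D orc s (.pair (.nat n) ctx) ≤ n * (B + 14) + B₀ + 5 := by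
  obtain ⟨y, h1, rfl, h2⟩ := loop_inv ho hf n ctx
    (fun i x t => x = acc i ∧ t ≤ i * (B + 14) + B₀ + 5)
    ⟨_, h0, rfl, by omega⟩ (by
      rintro i hi x t ⟨rfl, ht⟩
      refine ⟨_, hs i hi, rfl, ?_⟩
      have := ts i hi
      rw [Nat.succ_mul]
      omega)
  exact ⟨h1, h2⟩

/-- Body of a function that tabulates a list: the argument is the length, the length again, and
further data; `elem` sees the index, and the further data as `snd (snd (var 2))`. -/
def tabBody (s : ℕ) (elem : Code) : Code :=
  loopBody s (.lit 0)
    (.mk (.letIn (.bin .sub (.fst (.snd (.var 1))) (.fst (.var 1))) elem) (.var 0))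

/-- Lists grow at the front, so the round with counter `i + 1` prepends the entry with index `n - (i
+ 1)`. The second copy of the length survives the countdown and makes this index computable. -/
theorem tab_eq (ho : OracleDet orc) {s : ℕ} {elem : Code}
    (hf : D[s]? = some (tabBody s elem)) (n : ℕ) (ctx : Val) (F : Fin n → Val) (B : ℕ)
    (hs : ∀ (j : Fin n) (x y : Val),
      evalV D orc [.nat j, x, .pair y (.pair (.nat n) ctx)] elem = some (F j))
    (ts : ∀ (j : Fin n) (x y : Val),
      evalT D orc [.nat j, x, .pair y (.pair (.nat n) ctx)] elem ≤ B) :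
    valF D orc s (.pair (.nat n) (.pair (.nat n) ctx)) = some (encList (List.ofFn F)) ∧
      costF D orc s (.pair (.nat n) (.pair (.nat n) ctx)) ≤ n * (B + 23) + 6 := by
  have hd : ∀ i, ∀ h : i < n, (List.ofFn F).drop (n - (i + 1)) =
      F ⟨n - (i + 1), by omega⟩ :: (List.ofFn F).drop (n - i) := by
    intro i hi
    rw [List.drop_eq_getElem_cons (by simp; omega)]
    simp
    omega
  have := loop_eq ho hf n (.pair (.nat n) ctx)
    (fun i => encList ((List.ofFn F).drop (n - i))) (B + 9) 1
    (by simp [evalV, List.drop_eq_nil_of_le, encList]) (by simp [evalT])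
    (by
      intro i hi
      have := hs ⟨n - (i + 1), by omega⟩ (encList ((List.ofFn F).drop (n - i))) (.nat (i + 1))
      rw [hd i hi]
      simp [evalV, encList] at this ⊢
      simp [this])
    (by
      intro i hi
      have := ts ⟨n - (i + 1), by omega⟩ (encList ((List.ofFn F).drop (n - i))) (.nat (i + 1))
      simp [evalT, evalV] at this ⊢
      omega)
  simpa using this

end Fragments

/-! ### The program -/

section TheProgram

/-- The `j`-th entry of a list of `n` entries, by the function `b + 1`. -/
abbrev Code.get (b : ℕ) (l j : Code) : Code := .call (b + 1) (.mk l j)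

/-- The number of nodes, from the argument of `branchBody`. -/
abbrev nodesOf (e : Code) : Code := .fst (.snd (.snd (.snd (.snd e))))

/-- The argument of `branchBody` after the first pending node has got the label `k`. -/
abbrev assignCode (b : ℕ) (e k : Code) : Code :=
  .mk (.snd (.fst e)) (.mk (.call (b + 10) (.mk (nodesOf e) (.mk (nodesOf e)
    (.mk (.fst (.snd e)) (.mk (.fst (.fst e)) k))))) (.snd (.snd e)))

/-- List access: `(l, i) ↦ l[i]`. -/
def getBody (b : ℕ) : Code :=
  .ite (.bin .le (.lit 1) (.snd (.var 0)))
    (.get b (.snd (.fst (.var 0))) (.bin .sub (.snd (.var 0)) (.lit 1)))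
    (.fst (.fst (.var 0)))

/-- Length of a list. -/
def lenBody (b : ℕ) : Code :=
  .ite (.un .isPair (.var 0)) (.bin .add (.lit 1) (.call (b + 2) (.snd (.var 0)))) (.lit 0)

/-- The list of all nodes, in decreasing order. -/
def nodesBody (b : ℕ) : Code :=
  loopBody (b + 3) (.lit 0) (.mk (.bin .sub (.fst (.var 1)) (.lit 1)) (.var 0))

/-- `(f, k) ↦ {x | f x = k}`. -/
def blockBody (b : ℕ) : Code :=
  tabBody (b + 4)
    (.eq (.get b (.fst (.snd (.snd (.var 2)))) (.var 0)) (.snd (.snd (.snd (.var 2)))))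

/-- Total value of a labelling. -/
def valueBody (b : ℕ) : Code :=
  loopBody (b + 5) (.un .toReal (.lit 0))
    (.bin .add (.var 0) (.query (.call (b + 4) (.mk (.fst (.snd (.var 1)))
      (.mk (.fst (.snd (.var 1))) (.mk (.snd (.snd (.var 1))) (.fst (.var 1))))))))

/-- Row of the adjacency matrix of an induced subgraph. -/
def rowBody (b : ℕ) : Code :=
  tabBody (b + 6)
    (.get b (.get b (.snd (.snd (.snd (.snd (.var 2)))))
      (.get b (.fst (.snd (.snd (.snd (.var 2))))) (.fst (.snd (.snd (.var 2))))))
      (.get b (.fst (.snd (.snd (.snd (.var 2))))) (.var 0)))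

/-- Adjacency matrix of an induced subgraph. -/
def subgraphBody (b : ℕ) : Code :=
  tabBody (b + 7)
    (.call (b + 6) (.mk (.fst (.snd (.var 2))) (.mk (.fst (.snd (.var 2)))
      (.mk (.var 0) (.snd (.snd (.var 2)))))))

/-- The entries of a list whose indices are in both of two sets. -/
def interBody (b : ℕ) : Code :=
  loopBody (b + 8) (.lit 0)
    (.ite (.get b (.fst (.snd (.snd (.var 1)))) (.bin .sub (.fst (.var 1)) (.lit 1)))
      (.ite (.get b (.snd (.snd (.snd (.var 1)))) (.bin .sub (.fst (.var 1)) (.lit 1)))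
        (.mk (.get b (.fst (.snd (.var 1))) (.bin .sub (.fst (.var 1)) (.lit 1))) (.var 0))
        (.var 0))
      (.var 0))

/-- The entries of a list whose indices are in the first, but not in the second of two sets. -/
def diffBody (b : ℕ) : Code :=
  loopBody (b + 9) (.lit 0)
    (.ite (.get b (.fst (.snd (.snd (.var 1)))) (.bin .sub (.fst (.var 1)) (.lit 1)))
      (.ite (.get b (.snd (.snd (.snd (.var 1)))) (.bin .sub (.fst (.var 1)) (.lit 1)))
        (.var 0)
        (.mk (.get b (.fst (.snd (.var 1))) (.bin .sub (.fst (.var 1)) (.lit 1))) (.var 0)))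
      (.var 0))

/-- Change of one entry of a list. -/
def updateBody (b : ℕ) : Code :=
  tabBody (b + 10)
    (.ite (.eq (.var 0) (.fst (.snd (.snd (.snd (.var 2))))))
      (.snd (.snd (.snd (.snd (.var 2)))))
      (.get b (.fst (.snd (.snd (.var 2)))) (.var 0)))

/-- Union of two partial labellings. -/
def mergeBody (b : ℕ) : Code :=
  tabBody (b + 11)
    (.ite (.get b (.fst (.snd (.snd (.var 2)))) (.var 0))
      (.get b (.fst (.snd (.snd (.var 2)))) (.var 0))
      (.get b (.snd (.snd (.snd (.var 2)))) (.var 0)))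

/-- Best extension of a partial labelling to a given list of nodes. -/
def solveBody (b : ℕ) : Code :=
  .ite (.un .isPair (.fst (.var 0)))
    (.letIn (.call (b + 2) (.fst (.var 0)))
      (.letIn (.call b (.mk (.var 0) (.call (b + 7) (.mk (.var 0) (.mk (.var 0)
        (.mk (.fst (.var 1)) (.snd (.snd (.snd (.var 1))))))))))
        (.letIn (.mk (.fst (.var 2)) (.var 0))
          (.call (b + 13) (.mk (.call (b + 8) (.mk (.var 2) (.var 0)))
            (.mk (.fst (.snd (.var 3)))
              (.mk (.call (b + 9) (.mk (.var 2) (.var 0)))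
                (.mk (.call (b + 9) (.mk (.var 2)
                  (.mk (.fst (.var 3)) (.mk (.snd (.var 1)) (.fst (.var 1))))))
                  (.snd (.snd (.var 3)))))))))))
    (.fst (.snd (.var 0)))

/-- Best extension of a partial labelling to a separator and the two parts. -/
def branchBody (b : ℕ) : Code :=
  .ite (.un .isPair (.fst (.var 0)))
    (.call (b + 14) (.mk (nodesOf (.var 0)) (.var 0)))
    (.call (b + 11) (.mk (nodesOf (.var 0)) (.mk (nodesOf (.var 0))
      (.mk (.call (b + 12) (.mk (.fst (.snd (.snd (.var 0))))
          (.mk (.fst (.snd (.var 0))) (.snd (.snd (.snd (.snd (.var 0))))))))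
        (.call (b + 12) (.mk (.fst (.snd (.snd (.snd (.var 0)))))
          (.mk (.fst (.snd (.var 0))) (.snd (.snd (.snd (.snd (.var 0))))))))))))

/-- Search over the labels of the first pending node. -/
def labelsBody (b : ℕ) : Code :=
  loopBody (b + 14)
    (.call (b + 13) (assignCode b (.snd (.var 0))
      (.bin .add (.fst (.fst (.snd (.var 0)))) (.lit 1))))
    (.ite (.eq (.get b (.fst (.snd (.snd (.var 1)))) (.bin .sub (.fst (.var 1)) (.lit 1)))
        (.fst (.var 1)))
      (.call (b + 15) (.mk (nodesOf (.snd (.var 1))) (.mk (.var 0)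
        (.call (b + 13) (assignCode b (.snd (.var 1)) (.fst (.var 1)))))))
      (.var 0))

/-- The better one of two labellings. -/
def betterBody (b : ℕ) : Code :=
  .ite (.bin .le (.call (b + 5) (.mk (.fst (.var 0)) (.mk (.fst (.var 0)) (.fst (.snd (.var 0))))))
      (.call (b + 5) (.mk (.fst (.var 0)) (.mk (.fst (.var 0)) (.snd (.snd (.var 0)))))))
    (.snd (.snd (.var 0))) (.fst (.snd (.var 0)))

/-- The list of all indices. -/
def idsBody (b : ℕ) : Code := tabBody (b + 16) (.var 0)

/-- The empty labelling. -/
def zerosBody (b : ℕ) : Code := tabBody (b + 17) (.lit 0)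

/-- Replacement of a label by another one. -/
def relabelBody (b : ℕ) : Code :=
  tabBody (b + 18)
    (.ite (.eq (.get b (.fst (.snd (.snd (.var 2)))) (.var 0))
        (.fst (.snd (.snd (.snd (.var 2))))))
      (.snd (.snd (.snd (.snd (.var 2)))))
      (.get b (.fst (.snd (.snd (.var 2)))) (.var 0)))

/-- Merging of the components along the edges of a node inside its coalition. -/
def joinBody (b : ℕ) : Code :=
  loopBody (b + 19) (.fst (.snd (.var 0)))
    (.ite (.get b (.get b (.snd (.snd (.snd (.snd (.snd (.var 1)))))) (.fst (.snd (.snd (.var 1)))))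
        (.bin .sub (.fst (.var 1)) (.lit 1)))
      (.ite (.eq (.get b (.fst (.snd (.snd (.snd (.var 1))))) (.fst (.snd (.snd (.var 1)))))
          (.get b (.fst (.snd (.snd (.snd (.var 1))))) (.bin .sub (.fst (.var 1)) (.lit 1))))
        (.call (b + 18) (.mk (.fst (.snd (.snd (.snd (.snd (.var 1))))))
          (.mk (.fst (.snd (.snd (.snd (.snd (.var 1))))))
            (.mk (.var 0) (.mk (.get b (.var 0) (.bin .sub (.fst (.var 1)) (.lit 1)))
              (.get b (.var 0) (.fst (.snd (.snd (.var 1))))))))))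
        (.var 0))
      (.var 0))

/-- The components of the coalitions of a labelling. -/
def componentsBody (b : ℕ) : Code :=
  loopBody (b + 20)
    (.call (b + 16) (.mk (.fst (.snd (.snd (.var 0))))
      (.mk (.fst (.snd (.snd (.var 0)))) (.lit 0))))
    (.call (b + 19) (.mk (.fst (.snd (.snd (.var 1)))) (.mk (.var 0)
      (.mk (.bin .sub (.fst (.var 1)) (.lit 1)) (.snd (.var 1))))))

/-- The list of the coalitions of a labelling whose labels are members of their coalitions. -/
def coalitionsBody (b : ℕ) : Code :=
  loopBody (b + 21) (.lit 0)
    (.ite (.eq (.get b (.snd (.snd (.var 1))) (.bin .sub (.fst (.var 1)) (.lit 1)))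
        (.bin .sub (.fst (.var 1)) (.lit 1)))
      (.mk (.call (b + 4) (.mk (.fst (.snd (.var 1))) (.mk (.fst (.snd (.var 1)))
        (.mk (.snd (.snd (.var 1))) (.bin .sub (.fst (.var 1)) (.lit 1)))))) (.var 0))
      (.var 0))

/-- The functions of the program, of which the first one has the number `b`. -/
def functions (b : ℕ) (finder : Code) : List Code :=
  [finder, getBody b, lenBody b, nodesBody b, blockBody b, valueBody b, rowBody b, subgraphBody b,
    interBody b, diffBody b, updateBody b, mergeBody b, solveBody b, branchBody b, labelsBody b,
    betterBody b, idsBody b, zerosBody b, relabelBody b, joinBody b, componentsBody b,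
    coalitionsBody b]

/-- The main expression. -/
def mainBody (b : ℕ) : Code :=
  .call (b + 21) (.mk (.fst (.var 0)) (.mk (.fst (.var 0))
    (.call (b + 20) (.mk (.fst (.var 0)) (.mk
      (.call (b + 12) (.mk (.call (b + 3) (.mk (.fst (.var 0)) (.lit 0)))
        (.mk (.call (b + 17) (.mk (.fst (.var 0)) (.mk (.fst (.var 0)) (.lit 0)))) (.var 0))))
      (.var 0))))))

/-- The program that uses the given program for finding separators. -/
def solver (p : Program) : Program where
  defs := p.defs ++ functions p.defs.length p.main
  main := mainBody p.defs.length

end TheProgram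

/-! ### Encodings, list access and label classes -/

section Basics

/-- A list of natural numbers indexed by the nodes. -/
def encNats {n : ℕ} (f : Fin n → ℕ) : Val := encList (List.ofFn fun i => Val.nat (f i))

/-- A partial labelling of the nodes by nodes. -/
def encLab {n : ℕ} (f : Fin n → Option (Fin n)) : Val :=
  encNats fun i => (f i).elim 0 fun k => k + 1

/-- A list of nodes. -/
def encVerts {n : ℕ} (l : List (Fin n)) : Val := encList (l.map fun i : Fin n => Val.nat i)

open Classical in
theorem encSet_eq {n : ℕ} (X : Set (Fin n)) :
    encSet X = encNats fun i => if i ∈ X then 1 else 0 := rfl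

theorem encList_injective : Function.Injective encList := by
  intro l
  induction l with
  | nil => intro l' h; cases l' with
    | nil => rfl
    | cons => simp [encList] at h
  | cons a l ih => intro l' h; cases l' with
    | nil => simp [encList] at h
    | cons => simp only [encList, Val.pair.injEq] at h; rw [h.1, ih h.2]

theorem encSet_injective {n : ℕ} : Function.Injective (encSet (n := n)) := by
  classical
  intro X Y h
  have h' := List.ofFn_injective (encList_injective h)
  ext i
  have := congrFun h' i
  by_cases h1 : i ∈ X <;> by_cases h2 : i ∈ Y <;> simp_all

/-- Encodings of sets are injective, so a query denotes at most one coalition. -/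
theorem valuationOracle_det {n : ℕ} (v : Finset (Fin n) → ℝ) : OracleDet (valuationOracle v) := by
  rintro x r r' ⟨C, hC, rfl⟩ ⟨C', hC', rfl⟩
  rw [Finset.coe_injective (encSet_injective (hC.trans hC'.symm))]

/-- The list `D` of functions contains those of our program. -/
def Contains (D : List Code) (b : ℕ) (finder : Code) : Prop :=
  ∀ i < 22, D[b + i]? = (functions b finder)[i]?

variable {n : ℕ} {D : List Code} {b : ℕ} {finder : Code} {v : Finset (Fin n) → ℝ}

theorem get_list (hD : Contains D b finder) (l : List Val) :
    ∀ i, ∀ h : i < l.length,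
      valF D (valuationOracle v) (b + 1) (.pair (encList l) (.nat i)) = some l[i] ∧
      costF D (valuationOracle v) (b + 1) (.pair (encList l) (.nat i)) = 14 * i + 8 := by
  have ho := valuationOracle_det v
  have hf : D[b + 1]? = some (getBody b) := hD 1 (by omega)
  induction l with
  | nil => intro i h; simp at h
  | cons a l ih =>
    intro i h
    cases i with
    | zero =>
      obtain ⟨h1, h2⟩ := valF_costF_of_evalV (x := .pair (encList (a :: l)) (.nat 0)) (y := a) ho hf
        (by simp [getBody, evalV, encList])
      refine ⟨by simpa using h1, ?_⟩
      rw [h2]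
      simp [getBody, evalT, evalV]
    | succ i =>
      obtain ⟨h3, h4⟩ := ih i (by simpa using h)
      obtain ⟨h1, h2⟩ := valF_costF_of_evalV (x := .pair (encList (a :: l)) (.nat (i + 1)))
        (y := l[i]'(by simpa using h)) ho hf (by simp [getBody, evalV, encList, h3])
      refine ⟨by simpa using h1, ?_⟩
      rw [h2]
      simp [getBody, evalT, evalV, encList, h4]
      omega

theorem get_ofFn (hD : Contains D b finder) {m : ℕ} (F : Fin m → Val) (i : Fin m) :
    valF D (valuationOracle v) (b + 1) (.pair (encList (List.ofFn F)) (.nat i)) = some (F i) := by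
  simpa using (get_list (v := v) hD (List.ofFn F) i (by simp)).1

theorem cost_get_ofFn (hD : Contains D b finder) {m : ℕ} (F : Fin m → Val) (i : Fin m) :
    costF D (valuationOracle v) (b + 1) (.pair (encList (List.ofFn F)) (.nat i)) = 14 * i + 8 := by
  simpa using (get_list (v := v) hD (List.ofFn F) i (by simp)).2

theorem get_nats (hD : Contains D b finder) {m : ℕ} (f : Fin m → ℕ) (i : Fin m) :
    valF D (valuationOracle v) (b + 1) (.pair (encNats f) (.nat i)) = some (.nat (f i)) :=
  get_ofFn hD _ i

theorem cost_get_nats (hD : Contains D b finder) {m : ℕ} (f : Fin m → ℕ) (i : Fin m) :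
    costF D (valuationOracle v) (b + 1) (.pair (encNats f) (.nat i)) = 14 * i + 8 :=
  cost_get_ofFn hD _ i

theorem encVerts_eq (l : List (Fin n)) :
    encVerts l = encNats fun i : Fin l.length => (l.get i : ℕ) := by
  simp only [encVerts, encNats]
  congr 1
  apply List.ext_getElem <;> simp

theorem len_list (hD : Contains D b finder) (l : List Val) :
    valF D (valuationOracle v) (b + 2) (encList l) = some (.nat l.length) ∧
      costF D (valuationOracle v) (b + 2) (encList l) = 8 * l.length + 4 := by
  have ho := valuationOracle_det v
  have hf : D[b + 2]? = some (lenBody b) := hD 2 (by omega)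
  induction l with
  | nil =>
    obtain ⟨h1, h2⟩ := valF_costF_of_evalV (x := encList []) (y := .nat 0) ho hf
      (by simp [lenBody, evalV, encList])
    refine ⟨by simpa using h1, ?_⟩
    rw [h2]
    simp [lenBody, evalT, evalV, encList]
  | cons a l ih =>
    obtain ⟨h1, h2⟩ := valF_costF_of_evalV (x := encList (a :: l)) (y := .nat (l.length + 1)) ho hf
      (by simp [lenBody, evalV, encList, ih.1, add_comm])
    refine ⟨by simpa using h1, ?_⟩
    rw [h2]
    simp [lenBody, evalT, evalV, encList, ih]
    omega

/-- All nodes with indices below a bound, in decreasing order. -/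
def nodesBelow (n : ℕ) : ℕ → List (Fin n)
  | 0 => []
  | i + 1 => if h : i < n then ⟨i, h⟩ :: nodesBelow n i else nodesBelow n i

theorem mem_nodesBelow {i : ℕ} {x : Fin n} : x ∈ nodesBelow n i ↔ (x : ℕ) < i := by
  induction i with
  | zero => simp [nodesBelow]
  | succ i ih =>
    have := x.isLt
    by_cases h : i < n
    · simp only [nodesBelow, h, dif_pos, List.mem_cons, ih, Fin.ext_iff]
      omega
    · simp only [nodesBelow, h, dif_neg, not_false_eq_true, ih]
      omega

theorem nodup_nodesBelow (i : ℕ) : (nodesBelow n i).Nodup := by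
  induction i with
  | zero => simp [nodesBelow]
  | succ i ih =>
    by_cases h : i < n
    · simp [nodesBelow, h, mem_nodesBelow, ih]
    · simp [nodesBelow, h, ih]

theorem nodes_eq (hD : Contains D b finder) :
    valF D (valuationOracle v) (b + 3) (.pair (.nat n) (.nat 0)) =
        some (encVerts (nodesBelow n n)) ∧
      costF D (valuationOracle v) (b + 3) (.pair (.nat n) (.nat 0)) ≤ 20 * n + 6 := by
  have ho := valuationOracle_det v
  have hf : D[b + 3]? = some (nodesBody b) := hD 3 (by omega)
  have := loop_eq ho hf n (.nat 0) (fun i => encVerts (nodesBelow n i)) 6 1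
    (by simp [evalV, nodesBelow, encVerts, encList]) (by simp [evalT])
    (by
      intro i hi
      simp [evalV, nodesBelow, hi, encVerts, encList])
    (by
      intro i hi
      simp [evalT])
  exact ⟨this.1, this.2.trans (by omega)⟩

theorem block_eq (hD : Contains D b finder) (f : Fin n → ℕ) (k : ℕ) :
    valF D (valuationOracle v) (b + 4) (.pair (.nat n) (.pair (.nat n) (.pair (encNats f) (.nat k))))
        = some (encSet {i | f i = k}) ∧
      costF D (valuationOracle v) (b + 4)
        (.pair (.nat n) (.pair (.nat n) (.pair (encNats f) (.nat k)))) ≤ 100 * (n + 1) ^ 2 := by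
  have ho := valuationOracle_det v
  have hf : D[b + 4]? = some (blockBody b) := hD 4 (by omega)
  have := tab_eq ho hf n (.pair (encNats f) (.nat k)) (fun i => .nat (if f i = k then 1 else 0))
    (30 * n + 49)
    (by
      intro j x y
      apply evalV_eq <;> simp [evalV, get_nats hD])
    (by
      intro j x y
      simp [evalT_eq, evalT, evalV, cost_get_nats hD]
      omega)
  refine ⟨?_, this.2.trans (by nlinarith)⟩
  rw [this.1, encSet_eq]
  simp only [encNats, Set.mem_ofPred_eq]
  congr!

end Basics

/-! ### Correctness and cost of the subroutines -/

section Subroutines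

variable {n : ℕ} {D : List Code} {b : ℕ} {finder : Code} {v : Finset (Fin n) → ℝ}

open Classical in
theorem get_set (hD : Contains D b finder) {m : ℕ} (X : Set (Fin m)) (i : Fin m) :
    valF D (valuationOracle v) (b + 1) (.pair (encSet X) (.nat i)) =
      some (.nat (if i ∈ X then 1 else 0)) :=
  get_ofFn hD _ i

theorem cost_get_set (hD : Contains D b finder) {m : ℕ} (X : Set (Fin m)) (i : Fin m) :
    costF D (valuationOracle v) (b + 1) (.pair (encSet X) (.nat i)) = 14 * i + 8 :=
  cost_get_ofFn hD _ i

theorem get_verts (hD : Contains D b finder) (l : List (Fin n)) (i : Fin l.length) :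
    valF D (valuationOracle v) (b + 1) (.pair (encVerts l) (.nat i)) = some (.nat (l.get i)) := by
  rw [encVerts_eq, get_nats hD]

theorem cost_get_verts (hD : Contains D b finder) (l : List (Fin n)) (i : Fin l.length) :
    costF D (valuationOracle v) (b + 1) (.pair (encVerts l) (.nat i)) = 14 * i + 8 := by
  rw [encVerts_eq, cost_get_nats hD]

theorem get_lab (hD : Contains D b finder) (f : Fin n → Option (Fin n)) (i : Fin n) :
    valF D (valuationOracle v) (b + 1) (.pair (encLab f) (.nat i)) =
      some (.nat ((f i).elim 0 fun k => k + 1)) :=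
  get_nats hD _ i

theorem cost_get_lab (hD : Contains D b finder) (f : Fin n → Option (Fin n)) (i : Fin n) :
    costF D (valuationOracle v) (b + 1) (.pair (encLab f) (.nat i)) = 14 * i + 8 :=
  cost_get_nats hD _ i

/-- The total value of the label classes of a partial labelling. -/
def labValue (v : Finset (Fin n) → ℝ) (f : Fin n → Option (Fin n)) : ℝ :=
  ∑ k : Fin n, v {i | f i = some k}

/-- Codes of labels are shifted by one, because `0` is reserved for nodes without a label. -/
theorem elim_succ_eq_iff (o : Option (Fin n)) (k : Fin n) :
    (o.elim 0 fun k => (k : ℕ) + 1) = k + 1 ↔ o = some k := by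
  cases o <;> simp [Fin.ext_iff]

theorem value_eq (hD : Contains D b finder) (f : Fin n → Option (Fin n)) :
    valF D (valuationOracle v) (b + 5) (.pair (.nat n) (.pair (.nat n) (encLab f))) =
        some (.real (labValue v f)) ∧
      costF D (valuationOracle v) (b + 5) (.pair (.nat n) (.pair (.nat n) (encLab f))) ≤
        200 * (n + 1) ^ 3 := by
  have ho := valuationOracle_det v
  have hf : D[b + 5]? = some (valueBody b) := hD 5 (by omega)
  have hb := fun k => block_eq (v := v) hD (fun i => (f i).elim 0 fun k => (k : ℕ) + 1) k
  have hq : ∀ k : Fin n, orcF (valuationOracle v)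
      (encSet {i | ((f i).elim 0 fun k => (k : ℕ) + 1) = k + 1}) =
        some (.real (v {i | f i = some k})) := by
    intro k
    apply orcF_eq ho
    refine ⟨_, ?_, rfl⟩
    congr 1
    ext i
    simp [elim_succ_eq_iff]
  -- After `i` rounds the accumulator holds the values of the first `i` label classes, written as a
  -- prefix sum of a list.
  have := loop_eq ho hf n (.pair (.nat n) (encLab f))
    (fun i => .real (((List.ofFn fun k : Fin n => v {i | f i = some k}).take i).sum))
    (100 * (n + 1) ^ 2 + 30) 2
    (by simp [evalV]) (by simp [evalT])
    (by
      intro i hi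
      have h := hq ⟨i, hi⟩
      have h' := (hb (i + 1)).1
      rw [List.take_add_one]
      simp only [encLab] at h h' ⊢
      simp [evalV, h', h, hi])
    (by
      intro i hi
      have h' := (hb (i + 1)).2
      simp only [encLab] at h' ⊢
      simp [evalT, evalV]
      omega)
  refine ⟨?_, this.2.trans (by ring_nf; nlinarith [Nat.zero_le (n ^ 2), Nat.zero_le (n ^ 3)])⟩
  rw [this.1, labValue, List.take_of_length_le (by simp), List.sum_ofFn]

theorem row_eq (hD : Contains D b finder) (G : SimpleGraph (Fin n)) (l : List (Fin n))
    (hl : l.Nodup) (i : Fin l.length) :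
    valF D (valuationOracle v) (b + 6) (.pair (.nat l.length) (.pair (.nat l.length) (.pair (.nat i)
        (.pair (encVerts l) (encList (List.ofFn fun i => encSet (G.neighborSet i))))))) =
        some (encSet ((G.comap l.get).neighborSet i)) ∧
      costF D (valuationOracle v) (b + 6) (.pair (.nat l.length) (.pair (.nat l.length)
        (.pair (.nat i) (.pair (encVerts l)
          (encList (List.ofFn fun i => encSet (G.neighborSet i))))))) ≤ 200 * (n + 1) ^ 2 := by
  have ho := valuationOracle_det v
  have hf : D[b + 6]? = some (rowBody b) := hD 6 (by omega)
  have hn : l.length ≤ n := by simpa using hl.length_le_card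
  have := tab_eq ho hf l.length (.pair (.nat i) (.pair (encVerts l)
    (encList (List.ofFn fun i => encSet (G.neighborSet i)))))
    (fun j => .nat (open Classical in if j ∈ (G.comap l.get).neighborSet i then 1 else 0))
    (56 * n + 100)
    (by
      intro j x y
      simp [evalV, get_verts hD, get_ofFn hD, get_set hD, -List.get_eq_getElem]
      rfl)
    (by
      intro j x y
      have h1 := (l.get i).isLt
      have h2 := (l.get j).isLt
      simp [evalT, evalV, get_verts hD, get_ofFn hD, cost_get_set hD, cost_get_verts hD,
        cost_get_ofFn hD, -List.get_eq_getElem]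
      omega)
  refine ⟨this.1, this.2.trans ?_⟩
  have := Nat.mul_le_mul_right (56 * n + 100 + 23) hn
  nlinarith

/-- The finder accepts only graphs on some `Fin m`, so the subgraph induced by `l` is renumbered by
positions in `l`. Absence of duplicates serves to bound `l.length` by `n` in the cost. -/
theorem subgraph_eq (hD : Contains D b finder) (G : SimpleGraph (Fin n)) (l : List (Fin n))
    (hl : l.Nodup) :
    valF D (valuationOracle v) (b + 7) (.pair (.nat l.length) (.pair (.nat l.length)
        (.pair (encVerts l) (encList (List.ofFn fun i => encSet (G.neighborSet i)))))) =
        some (encList (List.ofFn fun i => encSet ((G.comap l.get).neighborSet i))) ∧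
      costF D (valuationOracle v) (b + 7) (.pair (.nat l.length) (.pair (.nat l.length)
        (.pair (encVerts l) (encList (List.ofFn fun i => encSet (G.neighborSet i)))))) ≤
          300 * (n + 1) ^ 3 := by
  have ho := valuationOracle_det v
  have hf : D[b + 7]? = some (subgraphBody b) := hD 7 (by omega)
  have hn : l.length ≤ n := by simpa using hl.length_le_card
  have := tab_eq ho hf l.length (.pair (encVerts l)
    (encList (List.ofFn fun i => encSet (G.neighborSet i))))
    (fun i => encSet ((G.comap l.get).neighborSet i))
    (200 * (n + 1) ^ 2 + 30)
    (by
      intro j x y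
      simp [evalV, (row_eq hD G l hl j).1])
    (by
      intro j x y
      have := (row_eq (v := v) hD G l hl j).2
      simp [evalT, evalV]
      omega)
  refine ⟨this.1, this.2.trans ?_⟩
  have := Nat.mul_le_mul_right (200 * (n + 1) ^ 2 + 30 + 23) hn
  ring_nf at this ⊢
  nlinarith [Nat.zero_le (n ^ 2), Nat.zero_le (n ^ 3)]

open Classical in
/-- The entries of a list whose indices are in a set and below a bound. -/
noncomputable def pickBelow (l : List (Fin n)) (X : Set (Fin l.length)) (i : ℕ) : List (Fin n) :=
  ((nodesBelow l.length i).filter (· ∈ X)).map l.get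

/-- The entries of a list whose indices are in a set. -/
noncomputable def pick (l : List (Fin n)) (X : Set (Fin l.length)) : List (Fin n) :=
  pickBelow l X l.length

theorem encVerts_cons (i : Fin n) (l : List (Fin n)) :
    encVerts (i :: l) = .pair (.nat i) (encVerts l) := rfl

theorem pickBelow_zero (l : List (Fin n)) (X : Set (Fin l.length)) : pickBelow l X 0 = [] := rfl

open Classical in
theorem pickBelow_succ (l : List (Fin n)) (X : Set (Fin l.length)) (j : Fin l.length) :
    pickBelow l X (j + 1) = if j ∈ X then l.get j :: pickBelow l X j else pickBelow l X j := by
  by_cases h : j ∈ X <;> simp [pickBelow, nodesBelow, h]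

theorem inter_eq (hD : Contains D b finder) (l : List (Fin n)) (hl : l.Nodup)
    (A B : Set (Fin l.length)) :
    valF D (valuationOracle v) (b + 8) (.pair (.nat l.length) (.pair (encVerts l)
        (.pair (encSet A) (encSet B)))) = some (encVerts (pick l (A ∩ B))) ∧
      costF D (valuationOracle v) (b + 8) (.pair (.nat l.length) (.pair (encVerts l)
        (.pair (encSet A) (encSet B)))) ≤ 200 * (n + 1) ^ 2 := by
  have ho := valuationOracle_det v
  have hf : D[b + 8]? = some (interBody b) := hD 8 (by omega)
  have hn : l.length ≤ n := by simpa using hl.length_le_card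
  have := loop_eq ho hf l.length (.pair (encVerts l) (.pair (encSet A) (encSet B)))
    (fun i => encVerts (pickBelow l (A ∩ B) i))
    (42 * n + 80) 1
    (by simp [evalV, pickBelow_zero, encVerts, encList]) (by simp [evalT])
    (by
      intro i hi
      obtain ⟨j, rfl⟩ : ∃ j : Fin l.length, (j : ℕ) = i := ⟨⟨i, hi⟩, rfl⟩
      by_cases h1 : j ∈ A <;> by_cases h2 : j ∈ B <;>
        simp [evalV, pickBelow_succ, get_set hD, get_verts hD, encVerts_cons, h1, h2,
          -List.get_eq_getElem])
    (by
      intro i hi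
      obtain ⟨j, rfl⟩ : ∃ j : Fin l.length, (j : ℕ) = i := ⟨⟨i, hi⟩, rfl⟩
      by_cases h1 : j ∈ A <;> by_cases h2 : j ∈ B <;>
        simp [evalT, evalV, get_set hD, h1, h2, cost_get_set hD, cost_get_verts hD,
          -List.get_eq_getElem] <;> omega)
  refine ⟨this.1, this.2.trans ?_⟩
  have := Nat.mul_le_mul_right (42 * n + 80 + 14) hn
  nlinarith

theorem diff_eq (hD : Contains D b finder) (l : List (Fin n)) (hl : l.Nodup)
    (A B : Set (Fin l.length)) :
    valF D (valuationOracle v) (b + 9) (.pair (.nat l.length) (.pair (encVerts l)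
        (.pair (encSet A) (encSet B)))) = some (encVerts (pick l (A \ B))) ∧
      costF D (valuationOracle v) (b + 9) (.pair (.nat l.length) (.pair (encVerts l)
        (.pair (encSet A) (encSet B)))) ≤ 200 * (n + 1) ^ 2 := by
  have ho := valuationOracle_det v
  have hf : D[b + 9]? = some (diffBody b) := hD 9 (by omega)
  have hn : l.length ≤ n := by simpa using hl.length_le_card
  have := loop_eq ho hf l.length (.pair (encVerts l) (.pair (encSet A) (encSet B)))
    (fun i => encVerts (pickBelow l (A \ B) i))
    (42 * n + 80) 1
    (by simp [evalV, pickBelow_zero, encVerts, encList]) (by simp [evalT])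
    (by
      intro i hi
      obtain ⟨j, rfl⟩ : ∃ j : Fin l.length, (j : ℕ) = i := ⟨⟨i, hi⟩, rfl⟩
      by_cases h1 : j ∈ A <;> by_cases h2 : j ∈ B <;>
        simp [evalV, pickBelow_succ, get_set hD, get_verts hD, encVerts_cons, h1, h2,
          -List.get_eq_getElem])
    (by
      intro i hi
      obtain ⟨j, rfl⟩ : ∃ j : Fin l.length, (j : ℕ) = i := ⟨⟨i, hi⟩, rfl⟩
      by_cases h1 : j ∈ A <;> by_cases h2 : j ∈ B <;>
        simp [evalT, evalV, get_set hD, h1, h2, cost_get_set hD, cost_get_verts hD,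
          -List.get_eq_getElem] <;> omega)
  refine ⟨this.1, this.2.trans ?_⟩
  have := Nat.mul_le_mul_right (42 * n + 80 + 14) hn
  nlinarith

theorem update_eq (hD : Contains D b finder) (f : Fin n → Option (Fin n)) (y k : Fin n) :
    valF D (valuationOracle v) (b + 10) (.pair (.nat n) (.pair (.nat n) (.pair (encLab f)
        (.pair (.nat y) (.nat (k + 1)))))) = some (encLab (Function.update f y (some k))) ∧
      costF D (valuationOracle v) (b + 10) (.pair (.nat n) (.pair (.nat n) (.pair (encLab f)
        (.pair (.nat y) (.nat (k + 1)))))) ≤ 200 * (n + 1) ^ 2 := by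
  have ho := valuationOracle_det v
  have hf : D[b + 10]? = some (updateBody b) := hD 10 (by omega)
  have := tab_eq ho hf n (.pair (encLab f) (.pair (.nat y) (.nat (k + 1))))
    (fun i => .nat ((Function.update f y (some k) i).elim 0 fun k => (k : ℕ) + 1)) (14 * n + 60)
    (by
      intro j x z
      simp only [evalV]
      rw [evalV_eq (k := j) (l := y) _ _ _ (by simp [evalV]) (by simp [evalV])]
      by_cases h : j = y
      · subst h; simp
      · have h' : (j : ℕ) ≠ y := fun h' => h (Fin.ext h')
        simp [h, h', get_lab hD])
    (by
      intro j x z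
      simp only [evalT, evalV, evalT_eq]
      rw [evalV_eq (k := j) (l := y) _ _ _ (by simp [evalV]) (by simp [evalV])]
      by_cases h : j = y
      · subst h; simp
      · have h' : (j : ℕ) ≠ y := fun h' => h (Fin.ext h')
        simp [h', cost_get_lab hD]
        omega)
  exact ⟨this.1, this.2.trans (by nlinarith)⟩

theorem merge_eq (hD : Contains D b finder) (f g : Fin n → Option (Fin n)) :
    valF D (valuationOracle v) (b + 11) (.pair (.nat n) (.pair (.nat n) (.pair (encLab f)
        (encLab g)))) = some (encLab fun i => (f i).or (g i)) ∧
      costF D (valuationOracle v) (b + 11) (.pair (.nat n) (.pair (.nat n) (.pair (encLab f)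
        (encLab g)))) ≤ 200 * (n + 1) ^ 2 := by
  have ho := valuationOracle_det v
  have hf : D[b + 11]? = some (mergeBody b) := hD 11 (by omega)
  have := tab_eq ho hf n (.pair (encLab f) (encLab g))
    (fun i => .nat (((f i).or (g i)).elim 0 fun k => (k : ℕ) + 1)) (28 * n + 60)
    (by
      intro j x z
      cases h : f j <;> simp [evalV, get_lab hD, h, branchOn])
    (by
      intro j x z
      cases h : f j <;> simp [evalT, evalV, get_lab hD, cost_get_lab hD, h, branchOn] <;> omega)
  exact ⟨this.1, this.2.trans (by nlinarith)⟩

open Classical in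
theorem better_eq (hD : Contains D b finder) (f g : Fin n → Option (Fin n)) :
    valF D (valuationOracle v) (b + 15) (.pair (.nat n) (.pair (encLab f) (encLab g))) =
        some (encLab (if labValue v f ≤ labValue v g then g else f)) ∧
      costF D (valuationOracle v) (b + 15) (.pair (.nat n) (.pair (encLab f) (encLab g))) ≤
        500 * (n + 1) ^ 3 := by
  have ho := valuationOracle_det v
  have hf : D[b + 15]? = some (betterBody b) := hD 15 (by omega)
  obtain ⟨h1, h2⟩ := valF_costF_of_evalV (x := .pair (.nat n) (.pair (encLab f) (encLab g)))
    (y := encLab (if labValue v f ≤ labValue v g then g else f)) ho hf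
    (by simp [betterBody, evalV, value_eq hD]; split_ifs <;> rfl)
  refine ⟨h1, ?_⟩
  rw [h2]
  have h3 := (value_eq (v := v) hD f).2
  have h4 := (value_eq (v := v) hD g).2
  have h5 : 0 < (n + 1) ^ 3 := by positivity
  simp [betterBody, evalT, evalV, value_eq hD]
  omega

theorem ids_eq (hD : Contains D b finder) :
    valF D (valuationOracle v) (b + 16) (.pair (.nat n) (.pair (.nat n) (.nat 0))) =
        some (encNats fun i : Fin n => i) ∧
      costF D (valuationOracle v) (b + 16) (.pair (.nat n) (.pair (.nat n) (.nat 0))) ≤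
        30 * (n + 1) := by
  have ho := valuationOracle_det v
  have hf : D[b + 16]? = some (idsBody b) := hD 16 (by omega)
  have := tab_eq ho hf n (.nat 0) (fun i => .nat i) 1 (by simp [evalV]) (by simp [evalT])
  exact ⟨this.1, this.2.trans (by omega)⟩

theorem zeros_eq (hD : Contains D b finder) :
    valF D (valuationOracle v) (b + 17) (.pair (.nat n) (.pair (.nat n) (.nat 0))) =
        some (encLab fun _ : Fin n => none) ∧
      costF D (valuationOracle v) (b + 17) (.pair (.nat n) (.pair (.nat n) (.nat 0))) ≤
        30 * (n + 1) := by
  have ho := valuationOracle_det v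
  have hf : D[b + 17]? = some (zerosBody b) := hD 17 (by omega)
  have := tab_eq ho hf n (.nat 0) (fun _ => .nat 0) 1 (by simp [evalV]) (by simp [evalT])
  exact ⟨this.1, this.2.trans (by omega)⟩

/-- A total labelling of the nodes by nodes. -/
def encMap (m : Fin n → Fin n) : Val := encNats fun i => m i

theorem get_map (hD : Contains D b finder) (m : Fin n → Fin n) (i : Fin n) :
    valF D (valuationOracle v) (b + 1) (.pair (encMap m) (.nat i)) = some (.nat (m i)) :=
  get_nats hD _ i

theorem cost_get_map (hD : Contains D b finder) (m : Fin n → Fin n) (i : Fin n) :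
    costF D (valuationOracle v) (b + 1) (.pair (encMap m) (.nat i)) = 14 * i + 8 :=
  cost_get_nats hD _ i

theorem relabel_eq (hD : Contains D b finder) (m : Fin n → Fin n) (p q : Fin n) :
    valF D (valuationOracle v) (b + 18) (.pair (.nat n) (.pair (.nat n) (.pair (encMap m)
        (.pair (.nat p) (.nat q))))) = some (encMap fun x => if m x = p then q else m x) ∧
      costF D (valuationOracle v) (b + 18) (.pair (.nat n) (.pair (.nat n) (.pair (encMap m)
        (.pair (.nat p) (.nat q))))) ≤ 200 * (n + 1) ^ 2 := by
  have ho := valuationOracle_det v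
  have hf : D[b + 18]? = some (relabelBody b) := hD 18 (by omega)
  have := tab_eq ho hf n (.pair (encMap m) (.pair (.nat p) (.nat q)))
    (fun i => .nat (if m i = p then q else m i : Fin n)) (42 * n + 80)
    (by
      intro j x z
      simp only [evalV]
      rw [evalV_eq (k := m j) (l := p) _ _ _ (by simp [evalV, get_map hD]) (by simp [evalV])]
      by_cases h : m j = p
      · simp [h]
      · have h' : (m j : ℕ) ≠ p := fun h' => h (Fin.ext h')
        simp [h, h', get_map hD])
    (by
      intro j x z
      simp only [evalT, evalV, evalT_eq]
      rw [evalV_eq (k := m j) (l := p) _ _ _ (by simp [evalV, get_map hD]) (by simp [evalV])]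
      by_cases h : m j = p
      · simp [h, cost_get_map hD]; omega
      · have h' : (m j : ℕ) ≠ p := fun h' => h (Fin.ext h')
        simp [h', cost_get_map hD]
        omega)
  exact ⟨this.1, this.2.trans (by nlinarith)⟩

end Subroutines

/-! ### Valuations that are independent of disconnected members -/

section IDM

variable {V : Type} [DecidableEq V] {G : SimpleGraph V} {v : Finset V → ℝ}

/-- The defining identity lets the nodes of `Z` join the coalition one at a time, since none of them
is adjacent to `i`. -/
theorem IsIDM.marginal (hv : IsIDM G v) {i : V} {C : Finset V} (hi : i ∉ C) (Z : Finset V)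
    (hZC : Disjoint Z C) (hiZ : i ∉ Z) (hG : ∀ z ∈ Z, ¬ G.Adj i z) :
    v (insert i (C ∪ Z)) - v (C ∪ Z) = v (insert i C) - v C := by
  induction Z using Finset.induction_on with
  | empty => simp
  | insert z Z hz ih =>
    simp only [Finset.mem_insert, not_or, forall_eq_or_imp, Finset.disjoint_insert_left]
      at hZC hiZ hG
    rw [← ih hZC.2 hiZ.2 hG.2, hv i z (C ∪ Z) hiZ.1 hG.1 (by simp [hi, hiZ.2])
      (by simp [hz, hZC.1]), Finset.union_insert]

/-- A set that separates two others. -/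
theorem IsIDM.union_add (hv : IsIDM G v) (C X Z : Finset V) (hXC : Disjoint X C)
    (hZC : Disjoint Z C) (hXZ : Disjoint X Z) (hG : ∀ x ∈ X, ∀ z ∈ Z, ¬ G.Adj x z) :
    v (C ∪ X ∪ Z) + v C = v (C ∪ X) + v (C ∪ Z) := by
  induction X using Finset.induction_on with
  | empty => simp [add_comm]
  | insert x X hx ih =>
    simp only [Finset.mem_insert, forall_eq_or_imp, Finset.disjoint_insert_left] at hXC hXZ hG
    have h1 := ih hXC.2 hXZ.2 hG.2
    have h2 := hv.marginal (i := x) (C := C ∪ X) (by simp [hx, hXC.1]) Z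
      (by simp [hZC, hXZ.2.symm]) hXZ.1 hG.1
    rw [Finset.union_insert, Finset.insert_union]
    linarith

/-- No edge joins different pieces, so `IsIDM.union_add` with empty separator splits them off one by
one. This is why passing to connected components is free. -/
theorem IsIDM.eq_sum [Fintype V] (hv : IsIDM G v) (h0 : v ∅ = 0) (X : Finset V) (m : V → V)
    (hm : ∀ i ∈ X, ∀ j ∈ X, G.Adj i j → m i = m j) :
    v X = ∑ k, v (X.filter fun i => m i = k) := by
  -- The induction runs over the set of admitted labels, so that each step adds one whole piece.
  have key : ∀ S : Finset V, v (X.filter fun i => m i ∈ S) =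
      ∑ k ∈ S, v (X.filter fun i => m i = k) := by
    intro S
    induction S using Finset.induction_on with
    | empty => simp [h0]
    | insert k S hk ih =>
      rw [Finset.sum_insert hk, ← ih]
      have := hv.union_add ∅ (X.filter fun i => m i = k) (X.filter fun i => m i ∈ S) (by simp)
        (by simp) (by
          rw [Finset.disjoint_left]
          intro i h1 h2
          simp only [Finset.mem_filter] at h1 h2
          exact hk (h1.2 ▸ h2.2)) (by
          intro i h1 j h2 hij
          simp only [Finset.mem_filter] at h1 h2
          have := hm i h1.1 j h2.1 hij
          exact hk (h1.2 ▸ this ▸ h2.2))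
      simp only [Finset.empty_union, h0, add_zero] at this
      rw [← this, ← Finset.filter_or]
      simp
  simpa using key Finset.univ

end IDM

/-! ### Labellings -/

section Labellings

variable {n : ℕ} {G : SimpleGraph (Fin n)} {v : Finset (Fin n) → ℝ}

/-- The labelling `h` extends `f` to the nodes in `R`. -/
def ExtendsTo (f : Fin n → Option (Fin n)) (R : Finset (Fin n)) (h : Fin n → Option (Fin n)) :
    Prop :=
  (∀ i ∉ R, h i = f i) ∧ ∀ i ∈ R, h i ≠ none

/-- The labelling `g` is the best extension of `f` to the nodes in `R`. -/
def IsBest (v : Finset (Fin n) → ℝ) (f : Fin n → Option (Fin n)) (R : Finset (Fin n))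
    (g : Fin n → Option (Fin n)) : Prop :=
  ExtendsTo f R g ∧ ∀ h, ExtendsTo f R h → labValue v h ≤ labValue v g

/-- Every label in use is a member of its class. -/
def IsReduced (f : Fin n → Option (Fin n)) : Prop := ∀ i k, f i = some k → f k = some k

/-- The labels in use. -/
def labels (f : Fin n → Option (Fin n)) : Finset (Fin n) := {k | f k = some k}

theorem labValue_map (σ : Equiv.Perm (Fin n)) (h : Fin n → Option (Fin n)) :
    labValue v (fun i => (h i).map σ) = labValue v h := by
  unfold labValue
  rw [← Equiv.sum_comp σ]
  refine Finset.sum_congr rfl fun k _ => ?_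
  congr 1
  ext i
  cases h i <;> simp

theorem IsReduced.update {f : Fin n → Option (Fin n)} (hf : IsReduced f) {y k : Fin n}
    (hy : f y = none) (hk : k = y ∨ f k = some k) :
    IsReduced (Function.update f y (some k)) := by
  intro i l h
  have key : ∀ l, f l = some l → Function.update f y (some k) l = some l := by
    intro l hl
    rw [Function.update_of_ne, hl]
    rintro rfl
    simp [hy] at hl
  by_cases hi : i = y
  · subst hi
    simp only [Function.update_self, Option.some.injEq] at h
    subst h
    rcases hk with rfl | hk
    · simp
    · exact key _ hk
  · rw [Function.update_of_ne hi] at h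
    exact key _ (hf _ _ h)

theorem card_labels_update_le {f : Fin n → Option (Fin n)} (y k : Fin n) :
    (labels (Function.update f y (some k))).card ≤ (labels f).card + 1 := by
  refine (Finset.card_le_card (t := insert y (labels f)) ?_).trans (Finset.card_insert_le _ _)
  intro i hi
  by_cases h : i = y
  · simp [h]
  · simp only [labels, Finset.mem_filter, Finset.mem_univ, true_and,
      Function.update_of_ne h] at hi
    simp [labels, hi]

/-- Every extension can be relabelled such that a given node gets an old label or its own. -/
theorem exists_relabel {f : Fin n → Option (Fin n)} (hf : IsReduced f) {y : Fin n}
    {R : Finset (Fin n)} (hy : f y = none) (hyR : y ∉ R) {h : Fin n → Option (Fin n)}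
    (hh : ExtendsTo f (insert y R) h) :
    ∃ k, (k = y ∨ f k = some k) ∧ ∃ h', ExtendsTo (Function.update f y (some k)) R h' ∧
      labValue v h' = labValue v h := by
  obtain ⟨k, hk⟩ := Option.ne_none_iff_exists'.1 (hh.2 y (by simp))
  by_cases hfk : f k = some k
  · refine ⟨k, .inr hfk, h, ⟨?_, fun i hi => hh.2 i (by simp [hi])⟩, rfl⟩
    intro i hi
    by_cases hiy : i = y
    · subst hiy; simp [hk]
    · rw [Function.update_of_ne hiy]
      exact hh.1 i (by simp [hi, hiy])
  -- Neither `k` nor `y` is a label of `f`: a label in use is a member of its own class, whereas `f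
  -- k ≠ some k` and `f y = none`. Swapping the two names therefore leaves `f` untouched and gives
  -- `y` its own name.
  · refine ⟨y, .inl rfl, fun i => (h i).map (Equiv.swap k y), ⟨?_, ?_⟩, labValue_map _ _⟩
    · intro i hi
      by_cases hiy : i = y
      · subst hiy; simp [hk]
      · simp only [Function.update_of_ne hiy, hh.1 i (by simp [hi, hiy] : i ∉ insert y R)]
        cases hfi : f i with
        | none => rfl
        | some l =>
          have h1 := hf _ _ hfi
          simp only [Option.map_some, Option.some.injEq]
          apply Equiv.swap_apply_of_ne_of_ne
          · rintro rfl; exact hfk h1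
          · rintro rfl; simp [hy] at h1
    · intro i hi
      simpa using hh.2 i (by simp [hi])

/-- Within each label class the nodes labelled by `f` separate the part in `R₁` from the part in
`R₂`. Modularity is applied class by class and summed. -/
theorem labValue_add (hv : IsIDM G v) {f h : Fin n → Option (Fin n)} {R₁ R₂ : Finset (Fin n)}
    (h1 : ∀ i ∈ R₁, f i = none) (h2 : ∀ i ∈ R₂, f i = none) (h12 : Disjoint R₁ R₂)
    (hG : ∀ i ∈ R₁, ∀ j ∈ R₂, ¬ G.Adj i j) (hh : ExtendsTo f (R₁ ∪ R₂) h) :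
    labValue v h + labValue v f = labValue v (fun i => if i ∈ R₂ then none else h i) +
      labValue v (fun i => if i ∈ R₁ then none else h i) := by
  unfold labValue
  rw [← Finset.sum_add_distrib, ← Finset.sum_add_distrib]
  refine Finset.sum_congr rfl fun k _ => ?_
  have hd := Finset.disjoint_left.1 h12
  convert hv.union_add {i | f i = some k} (R₁.filter fun i => h i = some k)
    (R₂.filter fun i => h i = some k) ?_ ?_ ?_ ?_ using 2
  · congr 1
    ext i
    by_cases hi : i ∈ R₁
    · have := h1 i hi
      have := hd hi
      simp_all
    · by_cases hi' : i ∈ R₂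
      · have := h2 i hi'
        simp_all
      · have := hh.1 i (by simp [hi, hi'])
        simp_all
  · congr 1
    ext i
    by_cases hi : i ∈ R₁
    · have := h1 i hi
      have := hd hi
      simp_all
    · by_cases hi' : i ∈ R₂
      · have := h2 i hi'
        simp_all
      · have := hh.1 i (by simp [hi, hi'])
        simp_all
  · congr 1
    ext i
    by_cases hi : i ∈ R₁
    · have := h1 i hi
      have := hd hi
      simp_all
    · by_cases hi' : i ∈ R₂
      · have := h2 i hi'
        simp_all
      · have := hh.1 i (by simp [hi, hi'])
        simp_all
  · rw [Finset.disjoint_left]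
    intro i hi hi'
    simp only [Finset.mem_filter] at hi hi'
    simp [h1 i hi.1] at hi'
  · rw [Finset.disjoint_left]
    intro i hi hi'
    simp only [Finset.mem_filter] at hi hi'
    simp [h2 i hi.1] at hi'
  · exact Finset.disjoint_filter_filter h12
  · intro i hi j hj
    exact hG i (Finset.mem_filter.1 hi).1 j (Finset.mem_filter.1 hj).1

/-- By `labValue_add`, the value of an extension is the sum of the values of its two one-sided
restrictions minus the constant `labValue v f`, so the sides can be maximised separately. -/
theorem IsBest.merge (hv : IsIDM G v) {f g₁ g₂ : Fin n → Option (Fin n)}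
    {R₁ R₂ : Finset (Fin n)} (h1 : ∀ i ∈ R₁, f i = none) (h2 : ∀ i ∈ R₂, f i = none)
    (h12 : Disjoint R₁ R₂) (hG : ∀ i ∈ R₁, ∀ j ∈ R₂, ¬ G.Adj i j)
    (hg₁ : IsBest v f R₁ g₁) (hg₂ : IsBest v f R₂ g₂) :
    IsBest v f (R₁ ∪ R₂) fun i => (g₁ i).or (g₂ i) := by
  have hd := Finset.disjoint_left.1 h12
  have hext : ExtendsTo f (R₁ ∪ R₂) fun i => (g₁ i).or (g₂ i) := by
    constructor
    · intro i hi
      simp only [Finset.mem_union, not_or] at hi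
      simp [hg₁.1.1 i hi.1, hg₂.1.1 i hi.2]
    · intro i hi
      rcases Finset.mem_union.1 hi with hi | hi
      · have := hg₁.1.2 i hi
        simp [this]
      · have := hg₂.1.2 i hi
        simp [this]
  refine ⟨hext, fun h hh => ?_⟩
  have e1 := labValue_add hv h1 h2 h12 hG hh
  have e2 := labValue_add hv h1 h2 h12 hG hext
  have e3 : (fun i => if i ∈ R₂ then none else (g₁ i).or (g₂ i)) = g₁ := by
    funext i
    by_cases hi : i ∈ R₁
    · obtain ⟨k, hk⟩ := Option.ne_none_iff_exists'.1 (hg₁.1.2 i hi)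
      simp [hd hi, hk]
    · by_cases hi' : i ∈ R₂
      · simp [hi', hg₁.1.1 i hi, h2 i hi']
      · simp [hi', hg₁.1.1 i hi, hg₂.1.1 i hi']
  have e4 : (fun i => if i ∈ R₁ then none else (g₁ i).or (g₂ i)) = g₂ := by
    funext i
    by_cases hi : i ∈ R₁
    · simp [hi, hg₂.1.1 i (hd hi), h1 i hi]
    · by_cases hi' : i ∈ R₂
      · simp [hi, hg₁.1.1 i hi, h2 i hi']
      · simp [hi, hg₁.1.1 i hi, hg₂.1.1 i hi']
  rw [e3, e4] at e2
  have i1 := hg₁.2 (fun i => if i ∈ R₂ then none else h i) ⟨by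
    intro i hi
    by_cases hi' : i ∈ R₂
    · simp [hi', h2 i hi']
    · simp [hi', hh.1 i (by simp [hi, hi'])], by
    intro i hi
    simpa [hd hi] using hh.2 i (by simp [hi])⟩
  have i2 := hg₂.2 (fun i => if i ∈ R₁ then none else h i) ⟨by
    intro i hi
    by_cases hi' : i ∈ R₁
    · simp [hi', h1 i hi']
    · simp [hi', hh.1 i (by simp [hi, hi'])], by
    intro i hi
    have hi' : i ∉ R₁ := fun h => hd h hi
    simpa [hi'] using hh.2 i (by simp [hi])⟩
  linarith

end Labellings

/-! ### Partitions and their labellings -/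

section Partitions

variable {n : ℕ} {G : SimpleGraph (Fin n)} {v : Finset (Fin n) → ℝ}

/-- The class of a label. -/
def fiber (m : Fin n → Fin n) (k : Fin n) : Finset (Fin n) := {i | m i = k}

theorem mem_fiber {m : Fin n → Fin n} {i k : Fin n} : i ∈ fiber m k ↔ m i = k := by simp [fiber]

/-- An idempotent map has non-empty fibres exactly over its fixed points; the other summands are `v
∅ = 0`. -/
theorem sum_fibers {m : Fin n → Fin n} (hm : ∀ i, m (m i) = m i) (h0 : v ∅ = 0) :
    ∑ C ∈ ((Finset.univ : Finset (Fin n)).filter fun k => m k = k).image (fiber m), v C =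
      ∑ k, v (fiber m k) := by
  rw [Finset.sum_image]
  · rw [Finset.sum_filter]
    refine Finset.sum_congr rfl fun k _ => ?_
    split_ifs with h
    · rfl
    · rw [show fiber m k = ∅ from ?_, h0]
      ext i
      simp only [mem_fiber, Finset.notMem_empty, iff_false]
      rintro rfl
      exact h (hm i)
  · intro k hk l hl h
    simp only [Finset.coe_filter, Finset.mem_univ, true_and, Set.mem_ofPred_eq] at hk hl
    have : k ∈ fiber m l := h ▸ mem_fiber.2 hk
    rw [← mem_fiber.1 this, hk]

/-- The partition into the classes of a labelling. -/
def fiberPartition (m : Fin n → Fin n) (hm : ∀ i, m (m i) = m i) : CoalitionStructure (Fin n) :=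
  Finpartition.ofExistsUnique
    (((Finset.univ : Finset (Fin n)).filter fun k => m k = k).image (fiber m))
    (by simp)
    (by
      intro i _
      refine ⟨fiber m (m i), ?_, ?_⟩
      · exact ⟨Finset.mem_image_of_mem _ (by simp [hm]), mem_fiber.2 rfl⟩
      · rintro C ⟨hC, hi⟩
        obtain ⟨k, _, rfl⟩ := Finset.mem_image.1 hC
        rw [mem_fiber.1 hi])
    (by
      intro h
      obtain ⟨k, hk, h⟩ := Finset.mem_image.1 h
      have : k ∈ fiber m k := mem_fiber.2 (by simpa using hk)
      simp [h] at this)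

theorem fiberPartition_parts (m : Fin n → Fin n) (hm : ∀ i, m (m i) = m i) :
    (fiberPartition m hm).parts =
      ((Finset.univ : Finset (Fin n)).filter fun k => m k = k).image (fiber m) := rfl

theorem labValue_some (m : Fin n → Fin n) :
    labValue v (fun i => some (m i)) = ∑ k, v (fiber m k) := by
  simp [labValue, fiber]

/-- Labelling each node by the least member of its part works. Hence a best labelling competes with
every coalition structure. -/
theorem exists_labelling (h0 : v ∅ = 0) (Q : CoalitionStructure (Fin n)) :
    ∃ m : Fin n → Fin n, labValue v (fun i => some (m i)) = totalValue v Q := by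
  have hne : ∀ i, (Q.part i).Nonempty := fun i => ⟨i, Q.mem_part (Finset.mem_univ i)⟩
  have hpart : ∀ i j, j ∈ Q.part i → Q.part j = Q.part i := fun i j hj =>
    Q.part_eq_of_mem (Q.part_mem.2 (Finset.mem_univ i)) hj
  set m : Fin n → Fin n := fun i => (Q.part i).min' (hne i) with hm_def
  have hmem : ∀ i, m i ∈ Q.part i := fun i => Finset.min'_mem _ _
  have hcongr : ∀ i j, Q.part i = Q.part j → m i = m j := by
    intro i j h
    simp only [hm_def, h]
  have hm : ∀ i, m (m i) = m i := fun i => hcongr _ _ (hpart _ _ (hmem i))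
  have hfib : ∀ i, fiber m (m i) = Q.part i := by
    intro i
    ext j
    rw [mem_fiber]
    constructor
    · intro h
      have h1 := hpart _ _ (hmem j)
      have h2 := hpart _ _ (hmem i)
      rw [← h2, ← h, h1]
      exact Q.mem_part (Finset.mem_univ j)
    · exact fun h => hcongr _ _ (hpart _ _ h)
  refine ⟨m, ?_⟩
  rw [labValue_some, ← sum_fibers hm h0, totalValue]
  congr 1
  ext C
  simp only [Finset.mem_image, Finset.mem_filter, Finset.mem_univ, true_and]
  constructor
  · rintro ⟨k, hk, rfl⟩
    rw [← hk, hfib]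
    exact Q.part_mem.2 (Finset.mem_univ k)
  · intro hC
    obtain ⟨i, hi⟩ := Q.nonempty_of_mem_parts hC
    exact ⟨m i, hm i, by rw [hfib, Q.part_eq_of_mem hC hi]⟩

/-- The map `m` refines the classes of `g` without cutting an edge inside a class, so `IsIDM.eq_sum`
splits every class into fibres of `m`. After exchanging the sums, each non-empty fibre meets exactly
one class. -/
theorem sum_fiber_eq_labValue (hv : IsIDM G v) (h0 : v ∅ = 0) {g : Fin n → Option (Fin n)}
    (hg : ∀ i, g i ≠ none) {m : Fin n → Fin n} (h1 : ∀ i j, m i = m j → g i = g j)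
    (h2 : ∀ i j, G.Adj i j → g i = g j → m i = m j) :
    ∑ k, v (fiber m k) = labValue v g := by
  unfold labValue
  have e : ∀ k, v {i | g i = some k} =
      ∑ l, v (Finset.filter (fun i => m i = l) {i | g i = some k}) := by
    intro k
    apply hv.eq_sum h0
    intro i hi j hj hij
    simp only [Finset.mem_filter, Finset.mem_univ, true_and] at hi hj
    exact h2 i j hij (hi.trans hj.symm)
  rw [Finset.sum_congr rfl fun k _ => e k, Finset.sum_comm]
  refine Finset.sum_congr rfl fun l _ => ?_
  by_cases hl : ∃ i, m i = l
  · obtain ⟨i, rfl⟩ := hl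
    obtain ⟨k, hk⟩ := Option.ne_none_iff_exists'.1 (hg i)
    rw [Finset.sum_eq_single k]
    · congr 1
      ext j
      simp only [mem_fiber, Finset.mem_filter, Finset.mem_univ, true_and, iff_and_self]
      exact fun h => (h1 _ _ h).trans hk
    · intro k' _ hk'
      rw [← h0]
      congr 1
      ext j
      simp only [Finset.mem_filter, Finset.mem_univ, true_and, Finset.notMem_empty, iff_false,
        not_and]
      intro h h'
      rw [h1 _ _ h', hk] at h
      exact hk' (Option.some.inj h).symm
    · simp
  · have : ∀ X : Finset (Fin n), Finset.filter (fun i => m i = l) X = ∅ := by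
      intro X
      ext j
      simp only [Finset.mem_filter, Finset.notMem_empty, iff_false, not_and]
      exact fun _ h => hl ⟨j, h⟩
    simp [fiber, this, h0]

/-- The edges inside the coalitions of a labelling. -/
def innerGraph (G : SimpleGraph (Fin n)) (g : Fin n → Option (Fin n)) : SimpleGraph (Fin n) where
  Adj i j := G.Adj i j ∧ g i = g j
  symm := ⟨fun _ _ h => ⟨h.1.symm, h.2.symm⟩⟩
  loopless := ⟨fun _ h => G.irrefl h.1⟩

theorem eq_of_reachable {V β : Type} {H : SimpleGraph V} {φ : V → β}
    (hφ : ∀ i j, H.Adj i j → φ i = φ j) {i j : V} (h : H.Reachable i j) : φ i = φ j := by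
  rw [SimpleGraph.reachable_iff_reflTransGen] at h
  induction h with
  | refl => rfl
  | tail _ h ih => exact ih.trans (hφ _ _ h)

/-- The hypotheses say that the fibres of `m` are the connected components of the classes of `g`.
They have the same total value as `g`, and `g` is at least as good as the labelling of any `Q`. -/
theorem isSolution_fiberPartition (hv : IsIDM G v) (h0 : v ∅ = 0) {g : Fin n → Option (Fin n)}
    {f : Fin n → Option (Fin n)} (hg : IsBest v f Finset.univ g) {m : Fin n → Fin n}
    (hm : ∀ i, m (m i) = m i)
    (h1 : ∀ i j, m i = m j → (innerGraph G g).Reachable i j)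
    (h2 : ∀ i j, (innerGraph G g).Adj i j → m i = m j) :
    IsSolution G v (fiberPartition m hm) := by
  have hgm : ∀ i j, m i = m j → g i = g j := fun i j h =>
    eq_of_reachable (H := innerGraph G g) (φ := g) (fun _ _ h => h.2) (h1 i j h)
  constructor
  · intro C hC
    rw [fiberPartition_parts] at hC
    obtain ⟨k, hk, rfl⟩ := Finset.mem_image.1 hC
    have hk : m k = k := by simpa using hk
    rw [SimpleGraph.connected_iff_exists_forall_reachable]
    refine ⟨⟨k, by simp [mem_fiber, hk]⟩, ?_⟩
    rintro ⟨i, hi⟩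
    have hr := h1 k i (by rw [hk, mem_fiber.1 hi])
    rw [SimpleGraph.reachable_iff_reflTransGen] at hr
    -- The path has to be replayed in the induced subgraph, so membership in the fibre is carried
    -- along it.
    suffices ∃ h : i ∈ fiber m k, (G.induce (fiber m k : Set (Fin n))).Reachable
        ⟨k, mem_fiber.2 hk⟩ ⟨i, h⟩ from this.2
    clear hi
    induction hr with
    | refl => exact ⟨mem_fiber.2 hk, .refl _⟩
    | @tail x y _ hxy ih =>
      obtain ⟨hx, ih⟩ := ih
      have hy : y ∈ fiber m k := mem_fiber.2 ((h2 _ _ hxy).symm.trans (mem_fiber.1 hx))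
      refine ⟨hy, ih.trans (SimpleGraph.Adj.reachable ?_)⟩
      exact hxy.1
  · intro Q
    obtain ⟨m', hm'⟩ := exists_labelling h0 Q
    rw [← hm', totalValue, fiberPartition_parts, sum_fibers hm h0,
      sum_fiber_eq_labValue hv h0 (fun i => hg.1.2 i (Finset.mem_univ i)) hgm
        (fun i j hij hg => h2 i j ⟨hij, hg⟩)]
    exact hg.2 _ ⟨by simp, by simp⟩

end Partitions

/-! ### The recursive search -/

section Search

variable {n : ℕ} {D : List Code} {b : ℕ} {finder : Code} {v : Finset (Fin n) → ℝ}
  {G : SimpleGraph (Fin n)}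

theorem mem_pick {l : List (Fin n)} {X : Set (Fin l.length)} {x : Fin n} :
    x ∈ pick l X ↔ ∃ j ∈ X, l.get j = x := by
  simp [pick, pickBelow, mem_nodesBelow]

theorem nodup_pick {l : List (Fin n)} (hl : l.Nodup) (X : Set (Fin l.length)) :
    (pick l X).Nodup :=
  ((nodup_nodesBelow _).filter _).map (List.nodup_iff_injective_get.1 hl)

theorem length_pick (l : List (Fin n)) (X : Set (Fin l.length)) :
    (pick l X).length = X.ncard := by
  classical
  rw [pick, pickBelow, List.length_map,
    ← List.toFinset_card_of_nodup ((nodup_nodesBelow _).filter _), ← Set.ncard_coe_finset]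
  congr 1
  ext j
  simp [mem_nodesBelow]

theorem ExtendsTo.of_update {f g : Fin n → Option (Fin n)} {y k : Fin n} {T : Finset (Fin n)}
    (hy : y ∉ T) (h : ExtendsTo (Function.update f y (some k)) T g) :
    ExtendsTo f (insert y T) g := by
  constructor
  · intro i hi
    simp only [Finset.mem_insert, not_or] at hi
    rw [h.1 i hi.2, Function.update_of_ne hi.1]
  · intro i hi
    rcases Finset.mem_insert.1 hi with rfl | hi
    · simp [h.1 i hy]
    · exact h.2 i hi

theorem card_labels_filter_succ (f : Fin n → Option (Fin n)) (j : Fin n) :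
    ((labels f).filter fun k : Fin n => (k : ℕ) < j + 1).card =
      ((labels f).filter fun k : Fin n => (k : ℕ) < j).card + if f j = some j then 1 else 0 := by
  split_ifs with h
  · rw [← Finset.card_insert_of_notMem (a := j) (by simp)]
    congr 1
    ext k
    simp only [labels, Finset.mem_filter, Finset.mem_univ, true_and, Finset.mem_insert]
    constructor
    · rintro ⟨h1, h2⟩
      by_cases hk : k = j
      · exact .inl hk
      · exact .inr ⟨h1, lt_of_le_of_ne (by omega) fun h => hk (Fin.ext h)⟩
    · rintro (rfl | ⟨h1, h2⟩)
      · exact ⟨h, by omega⟩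
      · exact ⟨h1, by omega⟩
  · rw [add_zero]
    congr 1
    ext k
    simp only [labels, Finset.mem_filter, Finset.mem_univ, true_and]
    refine and_congr_right fun h1 => ⟨fun h2 => ?_, fun h2 => by omega⟩
    refine lt_of_le_of_ne (by omega) fun h3 => ?_
    rw [Fin.ext h3] at h1
    exact h h1

/-- By `exists_relabel` it suffices to try the own name of `y` and the labels in use. The loop
passes over all `n` labels, but only these candidates cause a recursive call; the other rounds cost
`O(n)` each. -/
theorem labels_spec (hD : Contains D b finder) {f : Fin n → Option (Fin n)} (hf : IsReduced f)
    {y : Fin n} {Y : List (Fin n)} {T : Finset (Fin n)} (hy : f y = none) (hyT : y ∉ T)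
    (r₁ r₂ adj : Val) (B : ℕ)
    (hB : ∀ k, (k = y ∨ f k = some k) → ∃ g,
      valF D (valuationOracle v) (b + 13) (.pair (encVerts Y)
        (.pair (encLab (Function.update f y (some k))) (.pair r₁ (.pair r₂ (.pair (.nat n) adj)))))
          = some (encLab g) ∧
      IsBest v (Function.update f y (some k)) T g ∧
      costF D (valuationOracle v) (b + 13) (.pair (encVerts Y)
        (.pair (encLab (Function.update f y (some k))) (.pair r₁ (.pair r₂ (.pair (.nat n) adj)))))
          ≤ B) :
    ∃ g, valF D (valuationOracle v) (b + 14) (.pair (.nat n) (.pair (encVerts (y :: Y))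
        (.pair (encLab f) (.pair r₁ (.pair r₂ (.pair (.nat n) adj)))))) = some (encLab g) ∧
      IsBest v f (insert y T) g ∧
      costF D (valuationOracle v) (b + 14) (.pair (.nat n) (.pair (encVerts (y :: Y))
        (.pair (encLab f) (.pair r₁ (.pair r₂ (.pair (.nat n) adj)))))) ≤
          100 * (n + 1) ^ 2 + (1 + (labels f).card) * (B + 900 * (n + 1) ^ 3) := by
  have ho := valuationOracle_det v
  have hL : D[b + 14]? = some (labelsBody b) := hD 14 (by omega)
  have hN : (n + 1) ^ 2 ≤ (n + 1) ^ 3 := Nat.pow_le_pow_right (by omega) (by omega)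
  have hN1 : 1 ≤ (n + 1) ^ 2 := Nat.one_le_pow _ _ (by omega)
  obtain ⟨x, hx, g, rfl, hg, hbest, ht⟩ := loop_inv ho hL n (.pair (encVerts (y :: Y))
    (.pair (encLab f) (.pair r₁ (.pair r₂ (.pair (.nat n) adj)))))
    -- The base case already tries `y` itself; after `i` rounds, the labels in use below `i` have
    -- been tried as well.
    (fun i x t => ∃ g, x = encLab g ∧ ExtendsTo f (insert y T) g ∧
      (∀ k : Fin n, (k = y ∨ ((k : ℕ) < i ∧ f k = some k)) → ∀ h,
        ExtendsTo (Function.update f y (some k)) T h → labValue v h ≤ labValue v g) ∧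
      t ≤ i * (28 * n + 80) + (1 + ((labels f).filter fun k : Fin n => (k : ℕ) < i).card) *
        (B + 900 * (n + 1) ^ 3))
    (by
      obtain ⟨g, h1, h2, h3⟩ := hB y (.inl rfl)
      have hu := update_eq (v := v) hD f y y
      refine ⟨encLab g, ?_, g, rfl, h2.1.of_update hyT, ?_, ?_⟩
      · simp [evalV, encVerts_cons, hu.1, h1]
      · rintro k (rfl | ⟨hk, _⟩) h hh
        · exact h2.2 h hh
        · omega
      · simp [evalT, evalV, encVerts_cons, hu.1]
        omega)
    (by
      rintro i hi _ t ⟨g, rfl, hg, hbest, ht⟩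
      obtain ⟨j, rfl⟩ : ∃ j : Fin n, (j : ℕ) = i := ⟨⟨i, hi⟩, rfl⟩
      have hc := card_labels_filter_succ f j
      -- Label `j` is in use exactly if entry `j` has code `j + 1`, which is the loop counter.
      have heq : evalV D (valuationOracle v) [encLab g, .pair (.nat (j + 1))
          (.pair (encVerts (y :: Y)) (.pair (encLab f) (.pair r₁ (.pair r₂ (.pair (.nat n) adj)))))]
          (.eq (.get b (.fst (.snd (.snd (.var 1)))) (.bin .sub (.fst (.var 1)) (.lit 1)))
            (.fst (.var 1))) = some (.nat (if f j = some j then 1 else 0)) := by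
        rw [evalV_eq (k := (f j).elim 0 fun k => k + 1) (l := j + 1) _ _ _
          (by simp [evalV, get_lab hD]) (by simp [evalV])]
        simp [elim_succ_eq_iff]
      by_cases hj : f j = some j
      · rw [if_pos hj] at heq hc
        obtain ⟨g', h1, h2, h3⟩ := hB j (.inr hj)
        have hu := update_eq (v := v) hD f y j
        have hb := better_eq (v := v) hD g g'
        refine ⟨_, ?_, (if labValue v g ≤ labValue v g' then g' else g), rfl, ?_, ?_, ?_⟩
        · simp only [evalV, heq]
          simp [encVerts_cons, hu.1, h1, hb.1]
        · split_ifs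
          · exact h2.1.of_update hyT
          · exact hg
        · intro k hk h hh
          have h4 : labValue v h ≤ labValue v g ∨ labValue v h ≤ labValue v g' := by
            rcases hk with hk | ⟨hk, hk'⟩
            · exact .inl (hbest k (.inl hk) h hh)
            · by_cases hkj : k = j
              · subst hkj
                exact .inr (h2.2 h hh)
              · exact .inl (hbest k (.inr ⟨lt_of_le_of_ne (by omega)
                  fun h => hkj (Fin.ext h), hk'⟩) h hh)
          split_ifs with h5
          · rcases h4 with h4 | h4 <;> linarith
          · rcases h4 with h4 | h4 <;> linarith
        · rw [hc]
          simp only [evalT, heq, evalT_eq]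
          simp [evalV, encVerts_cons, hu.1, h1, cost_get_lab hD, -Fin.val_fin_lt]
          have := hb.2
          have := hu.2
          have h14 : (j : ℕ) ≤ n := by omega
          nlinarith
      · rw [if_neg hj] at heq hc
        refine ⟨_, ?_, g, rfl, hg, ?_, ?_⟩
        · simp only [evalV, heq]
          simp
        · intro k hk h hh
          rcases hk with hk | ⟨hk, hk'⟩
          · exact hbest k (.inl hk) h hh
          · refine hbest k (.inr ⟨lt_of_le_of_ne (by omega) fun h => ?_, hk'⟩) h hh
            rw [Fin.ext h] at hk'
            exact hj hk'
        · rw [hc]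
          simp only [evalT, heq, evalT_eq]
          simp [evalV, cost_get_lab hD, -Fin.val_fin_lt]
          nlinarith)
  refine ⟨g, hx, ⟨hg, ?_⟩, ht.trans ?_⟩
  · intro h hh
    obtain ⟨k, hk, h', hh', he⟩ := exists_relabel hf hy hyT hh
    rw [← he]
    exact hbest k (hk.imp id fun hk => ⟨k.isLt, hk⟩) h' hh'
  · rw [Finset.filter_true_of_mem fun k _ => k.isLt]
    nlinarith

end Search

/-! ### Divide and conquer over separators -/

section Search

variable {n : ℕ} {D : List Code} {b : ℕ} {finder : Code} {v : Finset (Fin n) → ℝ}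
  {G : SimpleGraph (Fin n)}

/-- The adjacency matrix of a graph. -/
noncomputable def encAdj (G : SimpleGraph (Fin n)) : Val :=
  encList (List.ofFn fun i : Fin n => encSet (G.neighborSet i))

theorem encGraph_eq (G : SimpleGraph (Fin n)) : encGraph G = .pair (.nat n) (encAdj G) := rfl

theorem encVerts_nil : encVerts ([] : List (Fin n)) = .nat 0 := rfl

/-- The search for a best extension to the nodes in `l` is correct and takes at most `W` steps if
at most `M` labels are in use. -/
def Solves (D : List Code) (b : ℕ) (v : Finset (Fin n) → ℝ) (adj : Val) (M W : ℝ)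
    (l : List (Fin n)) : Prop :=
  ∀ f : Fin n → Option (Fin n), IsReduced f → (∀ i ∈ l, f i = none) → ((labels f).card : ℝ) ≤ M →
    ∃ g, valF D (valuationOracle v) (b + 12)
        (.pair (encVerts l) (.pair (encLab f) (.pair (.nat n) adj))) = some (encLab g) ∧
      IsBest v f l.toFinset g ∧
      (costF D (valuationOracle v) (b + 12)
        (.pair (encVerts l) (.pair (encLab f) (.pair (.nat n) adj))) : ℝ) ≤ W

/-- Induction on the pending separator nodes; when none is left, the two sides are solved and
merged. The term `5000 * (n + 1) ^ 3` added to the cost is a potential: since `2 ≤ Q`, multiplying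
it by `Q` pays for the overhead of a level, so the bound loses nothing beyond the factor `Q` per
node. -/
theorem branch_spec (hD : Contains D b finder) (hv : IsIDM G v) {adj : Val} {M W₁ W₂ Q : ℝ}
    (hMQ : M + 1 ≤ Q) (hQ : 2 ≤ Q) {R₁ R₂ : List (Fin n)} (h₁ : Solves D b v adj M W₁ R₁)
    (h₂ : Solves D b v adj M W₂ R₂) (h12 : ∀ i ∈ R₁, i ∉ R₂)
    (hG : ∀ i ∈ R₁, ∀ j ∈ R₂, ¬ G.Adj i j) (Y : List (Fin n)) :
    ∀ f : Fin n → Option (Fin n), IsReduced f → Y.Nodup → (∀ i ∈ Y, i ∉ R₁ ∧ i ∉ R₂) →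
      (∀ i ∈ Y, f i = none) → (∀ i ∈ R₁, f i = none) → (∀ i ∈ R₂, f i = none) →
      ((labels f).card : ℝ) + Y.length ≤ M →
      ∃ g, valF D (valuationOracle v) (b + 13) (.pair (encVerts Y) (.pair (encLab f)
          (.pair (encVerts R₁) (.pair (encVerts R₂) (.pair (.nat n) adj))))) = some (encLab g) ∧
        IsBest v f (Y.toFinset ∪ (R₁.toFinset ∪ R₂.toFinset)) g ∧
        (costF D (valuationOracle v) (b + 13) (.pair (encVerts Y) (.pair (encLab f)
          (.pair (encVerts R₁) (.pair (encVerts R₂) (.pair (.nat n) adj))))) : ℝ) +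
            5000 * (n + 1) ^ 3 ≤ Q ^ Y.length * (W₁ + W₂ + 2 * (5000 * (n + 1) ^ 3)) := by
  have ho := valuationOracle_det v
  have hB : D[b + 13]? = some (branchBody b) := hD 13 (by omega)
  have hN : (n + 1 : ℝ) ^ 2 ≤ (n + 1) ^ 3 := pow_le_pow_right₀ (by simp) (by omega)
  have hN1 : (1 : ℝ) ≤ (n + 1) ^ 3 := one_le_pow₀ (by simp)
  induction Y with
  | nil =>
    intro f hf _ _ _ hf1 hf2 hM
    simp only [List.length_nil, Nat.cast_zero, add_zero] at hM
    obtain ⟨g₁, v1, b1, c1⟩ := h₁ f hf hf1 hM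
    obtain ⟨g₂, v2, b2, c2⟩ := h₂ f hf hf2 hM
    have hm := merge_eq (v := v) hD g₁ g₂
    obtain ⟨e1, e2⟩ := valF_costF_of_evalV (x := .pair (encVerts []) (.pair (encLab f)
      (.pair (encVerts R₁) (.pair (encVerts R₂) (.pair (.nat n) adj)))))
      (y := encLab fun i => (g₁ i).or (g₂ i)) ho hB
      (by simp [branchBody, evalV, encVerts_nil, v1, v2,
        hm.1])
    refine ⟨_, e1, ?_, ?_⟩
    · simpa using b1.merge hv (by simpa using hf1) (by simpa using hf2)
        (by rw [Finset.disjoint_left]; simpa using h12) (by simpa using hG) b2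
    · rw [e2]
      have hm2 : (costF D (valuationOracle v) (b + 11) (.pair (.nat n) (.pair (.nat n)
        (.pair (encLab g₁) (encLab g₂)))) : ℝ) ≤ 200 * (n + 1) ^ 2 := by exact_mod_cast hm.2
      simp [branchBody, evalT, evalV, encVerts_nil, v1, v2]
      linarith
  | cons y Y ih =>
    intro f hf hY hYR hfY hf1 hf2 hM
    simp only [List.nodup_cons, List.mem_cons, forall_eq_or_imp] at hY hYR hfY
    have hyT : y ∉ Y.toFinset ∪ (R₁.toFinset ∪ R₂.toFinset) := by
      simp [hY.1, hYR.1.1, hYR.1.2]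
    have hne : ∀ {i : Fin n} {R : List (Fin n)}, i ∈ R → y ∉ R → i ≠ y := by
      rintro i R hi hy rfl
      exact hy hi
    have hrec : ∀ k, (k = y ∨ f k = some k) → _ := fun k hk =>
      ih (Function.update f y (some k)) (hf.update hfY.1 hk) hY.2 hYR.2
        (fun i hi => by rw [Function.update_of_ne (hne hi hY.1)]; exact hfY.2 i hi)
        (fun i hi => by rw [Function.update_of_ne (hne hi hYR.1.1)]; exact hf1 i hi)
        (fun i hi => by rw [Function.update_of_ne (hne hi hYR.1.2)]; exact hf2 i hi)
        (by
          have : ((labels (Function.update f y (some k))).card : ℝ) ≤ (labels f).card + 1 := by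
            exact_mod_cast card_labels_update_le y k
          simp only [List.length_cons, Nat.cast_add, Nat.cast_one] at hM
          linarith)
    set X : ℝ := Q ^ Y.length * (W₁ + W₂ + 2 * (5000 * (n + 1) ^ 3)) - 5000 * (n + 1) ^ 3 with hX
    have hX0 : 0 ≤ X := by
      obtain ⟨g, _, _, h⟩ := hrec y (.inl rfl)
      have : (0 : ℝ) ≤ costF D (valuationOracle v) (b + 13) (.pair (encVerts Y)
        (.pair (encLab (Function.update f y (some y)))
          (.pair (encVerts R₁) (.pair (encVerts R₂) (.pair (.nat n) adj))))) := Nat.cast_nonneg _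
      linarith
    -- `labels_spec` counts steps in natural numbers, hence the floor of the real bound `X`.
    obtain ⟨g, v1, b1, c1⟩ := labels_spec hD hf hfY.1 hyT (encVerts R₁) (encVerts R₂) adj ⌊X⌋₊
      (fun k hk => by
        obtain ⟨g, v1, b1, c1⟩ := hrec k hk
        exact ⟨g, v1, b1, Nat.le_floor (by linarith)⟩)
    obtain ⟨e1, e2⟩ := valF_costF_of_evalV (x := .pair (encVerts (y :: Y)) (.pair (encLab f)
      (.pair (encVerts R₁) (.pair (encVerts R₂) (.pair (.nat n) adj)))))
      (y := encLab g) ho hB (by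
        rw [encVerts_cons] at v1 ⊢
        simp [branchBody, evalV, v1])
    refine ⟨g, e1, by simpa [Finset.insert_union] using b1, ?_⟩
    rw [e2]
    have c2 : (costF D (valuationOracle v) (b + 14) (.pair (.nat n) (.pair (encVerts (y :: Y))
        (.pair (encLab f) (.pair (encVerts R₁) (.pair (encVerts R₂) (.pair (.nat n) adj)))))) : ℝ)
        ≤ 100 * (n + 1) ^ 2 + (1 + (labels f).card) * (⌊X⌋₊ + 900 * (n + 1) ^ 3) := by
      exact_mod_cast c1
    have c3 := Nat.floor_le hX0
    have c4 : (evalT D (valuationOracle v) [.pair (encVerts (y :: Y)) (.pair (encLab f)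
        (.pair (encVerts R₁) (.pair (encVerts R₂) (.pair (.nat n) adj))))] (branchBody b) : ℝ) ≤
        30 + (100 * (n + 1) ^ 2 + (1 + (labels f).card) * (⌊X⌋₊ + 900 * (n + 1) ^ 3)) := by
      refine le_trans ?_ (add_le_add_right c2 30)
      rw [encVerts_cons]
      simp [branchBody, evalT, evalV]
      linarith
    have c5 : (1 + (labels f).card : ℝ) ≤ Q := by
      have : (0 : ℝ) ≤ (y :: Y).length := Nat.cast_nonneg _
      linarith
    have c6 : (1 + (labels f).card : ℝ) * (⌊X⌋₊ + 900 * (n + 1) ^ 3) ≤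
        Q * (X + 900 * (n + 1) ^ 3) := by gcongr
    have c7 : Q ^ (y :: Y).length * (W₁ + W₂ + 2 * (5000 * (n + 1) ^ 3)) =
        Q * (X + 5000 * (n + 1) ^ 3) := by
      rw [hX, List.length_cons, pow_succ]
      ring
    rw [c7]
    nlinarith

/-- The recurrences for time and for labels are kept abstract as `S` and `σ`. Here `σ r` is a
reserve for the separator nodes still to be labelled along a branch below `r` open nodes: at most `M
- σ r` labels are in use on entry, so `Q ≥ M + 1` always covers them and the node's own name. -/
theorem solve_spec (hD : Contains D b finder) (hv : IsIDM G v) {M Q α : ℝ}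
    (hMQ : M + 1 ≤ Q) (hQ : 2 ≤ Q) (hα : α < 1) (s τ S σ : ℕ → ℝ)
    (hfind : ∀ l : List (Fin n), l.Nodup → l ≠ [] → ∃ A B : (G.comap l.get).Subgraph,
      IsSeparation (G.comap l.get) (s l.length) α A B ∧
      valF D (valuationOracle v) b (encGraph (G.comap l.get)) =
        some (.pair (encSet A.verts) (encSet B.verts)) ∧
      (costF D (valuationOracle v) b (encGraph (G.comap l.get)) : ℝ) ≤ τ l.length)
    (hS0 : 5000 * (n + 1) ^ 3 ≤ S 0)
    (hS : ∀ r r₁ r₂ y : ℕ, 0 < r → r ≤ n → y ≤ s r → r₁ ≤ α * r → r₂ ≤ α * r → r₁ + r₂ + y ≤ r →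
      τ r + 5000 * (n + 1) ^ 3 + Q ^ y * (S r₁ + S r₂ + 2 * (5000 * (n + 1) ^ 3)) ≤ S r)
    (hσ0 : ∀ r, 0 ≤ σ r)
    (hσ : ∀ r r₁ y : ℕ, 0 < r → y ≤ s r → r₁ ≤ α * r → y + σ r₁ ≤ σ r) :
    ∀ (r : ℕ) (l : List (Fin n)), l.Nodup → l.length = r →
      Solves D b v (encAdj G) (M - σ r) (S r) l := by
  have ho := valuationOracle_det v
  have hB : D[b + 12]? = some (solveBody b) := hD 12 (by omega)
  have hN : (n + 1 : ℝ) ^ 2 ≤ (n + 1) ^ 3 := pow_le_pow_right₀ (by simp) (by omega)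
  have hN0 : (n + 1 : ℝ) ≤ (n + 1) ^ 3 := le_self_pow₀ (by simp) (by omega)
  have hN1 : (1 : ℝ) ≤ (n + 1) ^ 3 := one_le_pow₀ (by simp)
  intro r
  induction r using Nat.strong_induction_on with
  | _ r IH =>
  intro l hl hlr f hf hfl hM
  rcases eq_or_ne l [] with rfl | hne
  · obtain ⟨e1, e2⟩ := valF_costF_of_evalV (x := .pair (encVerts []) (.pair (encLab f)
      (.pair (.nat n) (encAdj G)))) (y := encLab f) ho hB
      (by simp [solveBody, evalV, encVerts_nil])
    refine ⟨f, e1, ⟨⟨by simp, by simp⟩, ?_⟩, ?_⟩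
    · intro h hh
      rw [show h = f from funext fun i => hh.1 i (by simp)]
    · rw [e2]
      simp only [List.length_nil] at hlr
      subst hlr
      simp [solveBody, evalT, evalV, encVerts_nil]
      linarith
  · obtain ⟨A, B, hAB, hval, hcost⟩ := hfind l hl hne
    obtain ⟨hcov, hsep, hAs, hBs⟩ := hAB
    rw [Fintype.card_fin] at hAs hBs
    subst hlr
    set r := l.length with hlr
    have hr : 0 < r := List.length_pos_of_ne_nil hne
    have hrn : r ≤ n := by simpa using hl.length_le_card
    -- Since `α < 1`, both sides are strictly smaller, which makes the recursion terminate.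
    have hlt : ∀ m : ℕ, (m : ℝ) ≤ α * r → m < r := by
      intro m hm
      have : (0 : ℝ) < r := by exact_mod_cast hr
      have : (m : ℝ) < r := by nlinarith
      exact_mod_cast this
    have hverts : ∀ i, i ∈ A.verts ∨ i ∈ B.verts := by
      intro i
      have : i ∈ (A ⊔ B).verts := by rw [hcov]; trivial
      simpa using this
    have hinj := List.nodup_iff_injective_get.1 hl
    have hmem : ∀ (X : Set (Fin l.length)) j, l.get j ∈ pick l X ↔ j ∈ X := by
      intro X j
      rw [mem_pick]
      exact ⟨fun ⟨j', h, e⟩ => hinj e ▸ h, fun h => ⟨j, h, rfl⟩⟩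
    have hsub : ∀ (X : Set (Fin l.length)) i, i ∈ pick l X → i ∈ l := by
      intro X i hi
      obtain ⟨j, _, rfl⟩ := mem_pick.1 hi
      exact List.get_mem l j
    have hcount : (A.verts \ B.verts).ncard + (B.verts \ A.verts).ncard +
        (A.verts ∩ B.verts).ncard ≤ r := by
      have e1 := Set.ncard_inter_add_ncard_sdiff_eq_ncard A.verts B.verts
      have e2 : (B.verts \ A.verts ∪ A.verts).ncard ≤ r :=
        (Set.ncard_le_ncard (Set.subset_univ _)).trans (by rw [Set.ncard_univ, Nat.card_fin])
      rw [Set.ncard_union_eq Set.disjoint_sdiff_left] at e2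
      omega
    have sol₁ := IH _ (hlt _ hAs) (pick l (A.verts \ B.verts)) (nodup_pick hl _) (length_pick _ _)
    have sol₂ := IH _ (hlt _ hBs) (pick l (B.verts \ A.verts)) (nodup_pick hl _) (length_pick _ _)
    have hσ₁ := hσ r _ _ hr hsep hAs
    have hσ₂ := hσ r _ _ hr hsep hBs
    set y := (A.verts ∩ B.verts).ncard with hy
    set r₁ := (A.verts \ B.verts).ncard with hr₁
    set r₂ := (B.verts \ A.verts).ncard with hr₂
    have hmono : ∀ {W M₁ : ℝ} {l' : List (Fin n)}, M - σ r + y ≤ M₁ →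
        Solves D b v (encAdj G) M₁ W l' → Solves D b v (encAdj G) (M - σ r + y) W l' :=
      fun h H f h1 h2 h3 => H f h1 h2 (h3.trans h)
    -- The `y` separator nodes draw on the reserve: `y + σ r₁ ≤ σ r` gives `M - σ r + y ≤ M - σ r₁`,
    -- which is what the recursive calls require.
    obtain ⟨g, v1, b1, c1⟩ := branch_spec (Q := Q) hD hv (M := M - σ r + y)
      (by linarith [hσ0 r₁]) hQ
      (hmono (by linarith) sol₁) (hmono (by linarith) sol₂)
      (by
        intro i hi hi'
        obtain ⟨j, hj, rfl⟩ := mem_pick.1 hi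
        exact hj.2 ((hmem _ _).1 hi').1)
      (by
        intro i hi i' hi' hadj
        obtain ⟨j, hj, rfl⟩ := mem_pick.1 hi
        obtain ⟨j', hj', rfl⟩ := mem_pick.1 hi'
        -- Every edge lies in `A` or in `B` and then has both ends there, so no edge joins the two
        -- differences.
        have : (A ⊔ B).Adj j j' := by rw [hcov]; exact hadj
        rcases this with h | h
        · exact hj'.2 h.snd_mem
        · exact hj.2 h.fst_mem)
      (pick l (A.verts ∩ B.verts)) f hf (nodup_pick hl _)
      (by
        intro i hi
        obtain ⟨j, hj, rfl⟩ := mem_pick.1 hi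
        exact ⟨fun h => ((hmem _ _).1 h).2 hj.2, fun h => ((hmem _ _).1 h).2 hj.1⟩)
      (fun i hi => hfl i (hsub _ i hi)) (fun i hi => hfl i (hsub _ i hi))
      (fun i hi => hfl i (hsub _ i hi))
      (by rw [length_pick]; linarith)
    have hset : (pick l (A.verts ∩ B.verts)).toFinset ∪
        ((pick l (A.verts \ B.verts)).toFinset ∪ (pick l (B.verts \ A.verts)).toFinset) =
        l.toFinset := by
      ext i
      simp only [Finset.mem_union, List.mem_toFinset]
      constructor
      · rintro (h | h | h) <;> exact hsub _ _ h
      · intro h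
        obtain ⟨j, rfl⟩ := List.get_of_mem h
        rw [hmem, hmem, hmem]
        have := hverts j
        simp only [Set.mem_inter_iff, Set.mem_sdiff]
        tauto
    rw [hset] at b1
    have hlen := len_list (v := v) hD (l.map fun i : Fin n => Val.nat i)
    rw [List.length_map] at hlen
    have hsubg := subgraph_eq (v := v) hD G l hl
    have hint := inter_eq (v := v) hD l hl A.verts B.verts
    have hdif := diff_eq (v := v) hD l hl A.verts B.verts
    have hdif' := diff_eq (v := v) hD l hl B.verts A.verts
    have hH : encGraph (G.comap l.get) = .pair (.nat l.length)
      (encList (List.ofFn fun i => encSet ((G.comap l.get).neighborSet i))) := rfl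
    rw [hH] at hval hcost
    have hpair : UnOp.isPair.apply (encVerts l) = some (.nat 1) := by
      cases l with
      | nil => exact absurd rfl hne
      | cons => rfl
    change valF D _ _ (encVerts l) = _ ∧ costF D _ _ (encVerts l) = _ at hlen
    change valF D _ _ (Val.pair _ (Val.pair _ (Val.pair _ (encAdj G)))) = _ ∧
      costF D _ _ (Val.pair _ (Val.pair _ (Val.pair _ (encAdj G)))) ≤ _ at hsubg
    obtain ⟨e1, e2⟩ := valF_costF_of_evalV (x := .pair (encVerts l) (.pair (encLab f)
      (.pair (.nat n) (encAdj G)))) (y := encLab g) ho hB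
      (by simp [solveBody, evalV, hpair, hlen.1, hsubg.1, hval, hint.1, hdif.1, hdif'.1, v1])
    refine ⟨g, e1, b1, ?_⟩
    rw [e2]
    refine le_trans ?_ (hS r r₁ r₂ y hr hrn hsep hAs hBs hcount)
    rw [length_pick, ← hy] at c1
    have q1 : (costF D (valuationOracle v) (b + 2) (encVerts l) : ℝ) ≤ 8 * n + 4 := by
      have : costF D (valuationOracle v) (b + 2) (encVerts l) ≤ 8 * n + 4 := by omega
      exact_mod_cast this
    have q2 := (Nat.cast_le (α := ℝ)).2 hsubg.2
    have q3 := (Nat.cast_le (α := ℝ)).2 hint.2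
    have q4 := (Nat.cast_le (α := ℝ)).2 hdif.2
    have q5 := (Nat.cast_le (α := ℝ)).2 hdif'.2
    push_cast at q2 q3 q4 q5
    simp [solveBody, evalT, evalV, hpair, hlen.1, hsubg.1, hval, hint.1, hdif.1, hdif'.1]
    linarith

end Search

/-! ### Connected components and output -/

section Output

variable {n : ℕ} {D : List Code} {b : ℕ} {finder : Code} {v : Finset (Fin n) → ℝ}
  {G : SimpleGraph (Fin n)}

/-- The classes of the idempotent labelling `m` are connected in `H`. -/
def IsConnectedMap (H : SimpleGraph (Fin n)) (m : Fin n → Fin n) : Prop :=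
  (∀ x, m (m x) = m x) ∧ ∀ x y, m x = m y → H.Reachable x y

/-- Two classes are merged along the edge `ij`, through which their members reach each other. -/
theorem IsConnectedMap.relabel {H : SimpleGraph (Fin n)} {m : Fin n → Fin n}
    (hm : IsConnectedMap H m) {i j : Fin n} (hij : H.Adj i j) :
    IsConnectedMap H fun x => if m x = m j then m i else m x := by
  constructor
  · intro x
    by_cases hx : m x = m j
    · simp [hx, hm.1]
    · simp [hx, hm.1]
  · intro x y hxy
    by_cases hx : m x = m j <;> by_cases hy : m y = m j <;> simp only [hx, hy, if_true, if_false]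
      at hxy
    · exact hm.2 x y (hx.trans hy.symm)
    · exact ((hm.2 x j hx).trans hij.symm.reachable).trans (hm.2 i y hxy)
    · exact (hm.2 x i hxy).trans (hij.reachable.trans (hm.2 j y hy.symm))
    · exact hm.2 x y hxy

/-- Classes only grow, so edges absorbed in earlier rounds stay inside a class; this monotonicity is
part of the conclusion for use in the outer loop. -/
theorem join_spec (hD : Contains D b finder) (g : Fin n → Option (Fin n)) (i : Fin n)
    {m : Fin n → Fin n} (hm : IsConnectedMap (innerGraph G g) m) :
    ∃ m', valF D (valuationOracle v) (b + 19) (.pair (.nat n) (.pair (encMap m) (.pair (.nat i)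
        (.pair (encLab g) (.pair (.nat n) (encAdj G)))))) = some (encMap m') ∧
      IsConnectedMap (innerGraph G g) m' ∧ (∀ x y, m x = m y → m' x = m' y) ∧
      (∀ j, (innerGraph G g).Adj i j → m' i = m' j) ∧
      costF D (valuationOracle v) (b + 19) (.pair (.nat n) (.pair (encMap m) (.pair (.nat i)
        (.pair (encLab g) (.pair (.nat n) (encAdj G)))))) ≤ 800 * (n + 1) ^ 3 := by
  classical
  have ho := valuationOracle_det v
  have hL : D[b + 19]? = some (joinBody b) := hD 19 (by omega)
  obtain ⟨x, hx, m', rfl, h1, h2, h3, h4⟩ := loop_inv ho hL n (.pair (encMap m) (.pair (.nat i)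
        (.pair (encLab g) (.pair (.nat n) (encAdj G)))))
    (fun k x t => ∃ m', x = encMap m' ∧ IsConnectedMap (innerGraph G g) m' ∧
      (∀ x y, m x = m y → m' x = m' y) ∧
      (∀ j : Fin n, (j : ℕ) < k → (innerGraph G g).Adj i j → m' i = m' j) ∧
      t ≤ k * (200 * (n + 1) ^ 2 + 150 * (n + 1) + 150) + 20)
    (by
      refine ⟨encMap m, ?_, m, rfl, hm, fun _ _ h => h, fun j hj => absurd hj (by omega), ?_⟩
      · simp [evalV]
      · simp [evalT])
    (by
      rintro k hk _ t ⟨m', rfl, h1, h2, h3, h4⟩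
      obtain ⟨j, rfl⟩ : ∃ j : Fin n, (j : ℕ) = k := ⟨⟨k, hk⟩, rfl⟩
      have hadj : evalV D (valuationOracle v) [encMap m', .pair (.nat (j + 1)) (.pair (encMap m)
          (.pair (.nat i) (.pair (encLab g) (.pair (.nat n) (encAdj G)))))]
          (.get b (.get b (.snd (.snd (.snd (.snd (.snd (.var 1)))))) (.fst (.snd (.snd (.var 1)))))
            (.bin .sub (.fst (.var 1)) (.lit 1))) = some (.nat (if G.Adj i j then 1 else 0)) := by
        simp [evalV, encAdj, get_ofFn hD, get_set hD]
      have hadjT : evalT D (valuationOracle v) [encMap m', .pair (.nat (j + 1)) (.pair (encMap m)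
          (.pair (.nat i) (.pair (encLab g) (.pair (.nat n) (encAdj G)))))]
          (.get b (.get b (.snd (.snd (.snd (.snd (.snd (.var 1)))))) (.fst (.snd (.snd (.var 1)))))
            (.bin .sub (.fst (.var 1)) (.lit 1))) ≤ 28 * n + 60 := by
        simp [evalT, evalV, encAdj, get_ofFn hD, cost_get_set hD, cost_get_ofFn hD]
        omega
      have heq : evalV D (valuationOracle v) [encMap m', .pair (.nat (j + 1)) (.pair (encMap m)
          (.pair (.nat i) (.pair (encLab g) (.pair (.nat n) (encAdj G)))))]
          (.eq (.get b (.fst (.snd (.snd (.snd (.var 1))))) (.fst (.snd (.snd (.var 1)))))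
          (.get b (.fst (.snd (.snd (.snd (.var 1))))) (.bin .sub (.fst (.var 1)) (.lit 1)))) =
          some (.nat (if g i = g j then 1 else 0)) := by
        rw [evalV_eq (k := (g i).elim 0 fun k => k + 1) (l := (g j).elim 0 fun k => k + 1) _ _ _
          (by simp [evalV, get_lab hD]) (by simp [evalV, get_lab hD])]
        cases h : g j with
        | some l => simp only [Option.elim_some, elim_succ_eq_iff]
        | none => cases h' : g i <;> simp
      have hle : ∀ l : Fin n, (l : ℕ) < j + 1 → l ≠ j → (l : ℕ) < j := fun l h1 h2 =>
        lt_of_le_of_ne (by omega) fun h => h2 (Fin.ext h)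
      by_cases hij : (innerGraph G g).Adj i j
      · have h5 : G.Adj i j := hij.1
        have h6 : g i = g j := hij.2
        rw [if_pos h5] at hadj
        rw [if_pos h6] at heq
        have hr := relabel_eq (v := v) hD m' (m' j) (m' i)
        refine ⟨encMap fun x => if m' x = m' j then m' i else m' x, ?_, _, rfl, h1.relabel hij,
          ?_, ?_, ?_⟩
        · simp only [evalV] at hadj ⊢
          simp only [hadj]
          simp only [Option.bind_some, branchOn_one, heq]
          simp [get_map hD, hr.1]
        · intro x y hxy
          simp only [h2 x y hxy]
        · intro l hl hil
          by_cases hlj : l = j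
          · subst hlj; simp
          · simp only [h3 l (hle l hl hlj) hil]
        · rw [evalT, hadj]
          simp only [Option.elim_some, branchOn_one, evalT, evalT_eq, heq]
          simp [evalV, get_map hD, cost_get_lab hD, cost_get_map hD]
          simp [evalT, evalV] at hadjT
          have := hr.2
          have h14 : (j : ℕ) ≤ n := by omega
          have h15 : (i : ℕ) ≤ n := by omega
          nlinarith
      · refine ⟨encMap m', ?_, m', rfl, h1, h2, ?_, ?_⟩
        · by_cases h5 : G.Adj i j
          · have h6 : g i ≠ g j := fun h6 => hij ⟨h5, h6⟩
            rw [if_pos h5] at hadj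
            rw [if_neg h6] at heq
            simp only [evalV] at hadj ⊢
            simp only [hadj]
            simp only [Option.bind_some, branchOn_one, heq]
            simp
          · rw [if_neg h5] at hadj
            simp only [evalV] at hadj ⊢
            simp only [hadj]
            simp
        · intro l hl hil
          by_cases hlj : l = j
          · subst hlj; exact absurd hil hij
          · exact h3 l (hle l hl hlj) hil
        · have h14 : (j : ℕ) ≤ n := by omega
          have h15 : (i : ℕ) ≤ n := by omega
          by_cases h5 : G.Adj i j
          · have h6 : g i ≠ g j := fun h6 => hij ⟨h5, h6⟩
            rw [if_pos h5] at hadj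
            rw [if_neg h6] at heq
            rw [evalT, hadj]
            simp only [Option.elim_some, branchOn_one, evalT, evalT_eq, heq]
            simp [evalV, cost_get_lab hD]
            simp [evalT, evalV] at hadjT
            nlinarith
          · rw [if_neg h5] at hadj
            rw [evalT, hadj]
            simp [evalT, evalV] at hadjT ⊢
            nlinarith)
  refine ⟨m', hx, h1, h2, fun j hj => h3 j j.isLt hj, h4.trans ?_⟩
  ring_nf
  nlinarith [Nat.zero_le (n ^ 2), Nat.zero_le (n ^ 3)]

/-- Starting from singletons, classes are merged along the inner edges of one node after another.
They stay connected throughout, and in the end no inner edge leaves a class. -/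
theorem components_spec (hD : Contains D b finder) (g : Fin n → Option (Fin n)) :
    ∃ m, valF D (valuationOracle v) (b + 20) (.pair (.nat n) (.pair (encLab g)
        (.pair (.nat n) (encAdj G)))) = some (encMap m) ∧
      IsConnectedMap (innerGraph G g) m ∧
      (∀ i j, (innerGraph G g).Adj i j → m i = m j) ∧
      costF D (valuationOracle v) (b + 20) (.pair (.nat n) (.pair (encLab g)
        (.pair (.nat n) (encAdj G)))) ≤ 1000 * (n + 1) ^ 4 := by
  have ho := valuationOracle_det v
  have hL : D[b + 20]? = some (componentsBody b) := hD 20 (by omega)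
  obtain ⟨x, hx, m, rfl, h1, h2, h3⟩ := loop_inv ho hL n (.pair (encLab g)
        (.pair (.nat n) (encAdj G)))
    (fun k x t => ∃ m, x = encMap m ∧ IsConnectedMap (innerGraph G g) m ∧
      (∀ i : Fin n, (i : ℕ) < k → ∀ j, (innerGraph G g).Adj i j → m i = m j) ∧
      t ≤ k * (800 * (n + 1) ^ 3 + 50) + 30 * (n + 1) + 50)
    (by
      have hi := ids_eq (v := v) hD
      refine ⟨encMap id, ?_, id, rfl, ⟨fun _ => rfl, ?_⟩, fun j hj => absurd hj (by omega), ?_⟩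
      · simp [evalV, hi.1]
        rfl
      · rintro x y rfl
        exact .refl _
      · simp [evalT, evalV]
        omega)
    (by
      rintro k hk _ t ⟨m, rfl, h1, h2, h3⟩
      obtain ⟨i, rfl⟩ : ∃ i : Fin n, (i : ℕ) = k := ⟨⟨k, hk⟩, rfl⟩
      obtain ⟨m', e1, e2, e3, e4, e5⟩ := join_spec (v := v) hD g i h1
      refine ⟨encMap m', ?_, m', rfl, e2, ?_, ?_⟩
      · simp [evalV, e1]
      · intro l hl j hlj
        by_cases hli : l = i
        · subst hli; exact e4 j hlj
        · exact e3 _ _ (h2 l (lt_of_le_of_ne (by omega) fun h => hli (Fin.ext h)) j hlj)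
      · simp [evalT, evalV]
        rw [Nat.succ_mul]
        omega)
  refine ⟨m, hx, h1, fun i j hij => h2 i i.isLt j hij, h3.trans ?_⟩
  ring_nf
  nlinarith [Nat.zero_le (n ^ 2), Nat.zero_le (n ^ 3), Nat.zero_le (n ^ 4)]

/-- Each class has exactly one fixed point of `m`, so listing the classes of the fixed points lists
every coalition once. -/
theorem coalitions_spec (hD : Contains D b finder) {m : Fin n → Fin n}
    (hm : ∀ x, m (m x) = m x) :
    ∃ y, valF D (valuationOracle v) (b + 21) (.pair (.nat n) (.pair (.nat n) (encMap m))) =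
        some y ∧ EncodesCS (fiberPartition m hm) y ∧
      costF D (valuationOracle v) (b + 21) (.pair (.nat n) (.pair (.nat n) (encMap m))) ≤
        300 * (n + 1) ^ 3 := by
  have ho := valuationOracle_det v
  have hL : D[b + 21]? = some (coalitionsBody b) := hD 21 (by omega)
  have heq : ∀ (j : Fin n) (x : Val), evalV D (valuationOracle v)
      [x, .pair (.nat (j + 1)) (.pair (.nat n) (encMap m))]
      (.eq (.get b (.snd (.snd (.var 1))) (.bin .sub (.fst (.var 1)) (.lit 1)))
        (.bin .sub (.fst (.var 1)) (.lit 1))) = some (.nat (if m j = j then 1 else 0)) := by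
    intro j x
    rw [evalV_eq (k := m j) (l := j) _ _ _ (by simp [evalV, get_map hD]) (by simp [evalV])]
    simp [Fin.ext_iff]
  have hblock : ∀ k : Fin n, _ := fun k => block_eq (v := v) hD (fun i => (m i : ℕ)) k
  have hfib : ∀ k : Fin n, {i | (m i : ℕ) = k} = (fiber m k : Set (Fin n)) := by
    intro k
    ext i
    simp [mem_fiber, Fin.ext_iff]
  have := loop_eq ho hL n (.pair (.nat n) (encMap m))
    (fun i => encList ((((nodesBelow n i).filter fun k => m k = k).map (fiber m)).map
      fun C => encSet (C : Set (Fin n))))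
    (100 * (n + 1) ^ 2 + 28 * n + 80) 1
    (by simp [evalV, nodesBelow, encList]) (by simp [evalT])
    (by
      intro i hi
      obtain ⟨j, rfl⟩ : ∃ j : Fin n, (j : ℕ) = i := ⟨⟨i, hi⟩, rfl⟩
      have hb := (hblock j).1
      rw [hfib] at hb
      rw [evalV, heq]
      by_cases h : m j = j
      · have : nodesBelow n (j + 1) = j :: nodesBelow n j := by simp [nodesBelow]
        rw [this, List.filter_cons_of_pos (by simpa using h)]
        simp only [h, if_true, Option.bind_some, branchOn_one]
        simp [evalV, encMap, hb, encList]
      · have : nodesBelow n (j + 1) = j :: nodesBelow n j := by simp [nodesBelow]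
        rw [this, List.filter_cons_of_neg (by simpa using h)]
        simp [evalV, h])
    (by
      intro i hi
      obtain ⟨j, rfl⟩ : ∃ j : Fin n, (j : ℕ) = i := ⟨⟨i, hi⟩, rfl⟩
      have hb := (hblock j).2
      rw [evalT, heq, evalT_eq]
      by_cases h : m j = j
      · simp only [h, if_true, Option.elim_some, branchOn_one]
        simp only [encMap] at hb ⊢
        simp [evalT, evalV, cost_get_nats hD]
        omega
      · simp [evalT, evalV, h, cost_get_map hD]
        omega)
  refine ⟨_, this.1, ⟨_, ?_, ?_, rfl⟩, this.2.trans ?_⟩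
  · refine List.Nodup.map_on ?_ ((nodup_nodesBelow n).filter _)
    intro k hk l hl h
    have hk := (List.mem_filter.1 hk).2
    have hl := (List.mem_filter.1 hl).2
    simp only [decide_eq_true_eq] at hk hl
    have : k ∈ fiber m l := h ▸ mem_fiber.2 hk
    rw [← mem_fiber.1 this, hk]
  · rw [fiberPartition_parts]
    ext C
    simp [mem_nodesBelow]
  · ring_nf
    nlinarith [Nat.zero_le (n ^ 2), Nat.zero_le (n ^ 3)]

theorem main_spec (hD : Contains D b finder) (hv : IsIDM G v) (h0 : v ∅ = 0) {M W : ℝ}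
    (hM : 0 ≤ M) (hs : Solves D b v (encAdj G) M W (nodesBelow n n)) :
    ∃ (P : CoalitionStructure (Fin n)) (y : Val) (k : ℕ),
      (k : ℝ) ≤ W + 2000 * (n + 1) ^ 4 ∧ IsSolution G v P ∧ EncodesCS P y ∧
        Steps D (valuationOracle v) [encGraph G] (mainBody b) y k := by
  have ho := valuationOracle_det v
  -- The search starts from the empty labelling, which is reduced and uses no label, so `0 ≤ M` is
  -- enough.
  obtain ⟨g, v1, b1, c1⟩ := hs (fun _ => none) (by intro i k h; simp at h) (by simp)
    (by simpa [labels] using hM)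
  obtain ⟨m, v2, hm, hm', c2⟩ := components_spec (v := v) (G := G) hD g
  obtain ⟨y, v3, hy, c3⟩ := coalitions_spec (v := v) hD hm.1
  have hz := zeros_eq (v := v) hD
  have hn := nodes_eq (v := v) hD
  have huniv : (nodesBelow n n).toFinset = Finset.univ := by
    ext i
    simp [mem_nodesBelow]
  rw [huniv] at b1
  have he : evalV D (valuationOracle v) [encGraph G] (mainBody b) = some y := by
    simp [mainBody, evalV, encGraph_eq, hz.1, hn.1, v1, v2, v3]
  refine ⟨_, y, _, ?_, isSolution_fiberPartition hv h0 b1 hm.1 hm.2 hm', hy,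
    steps_of_evalV ho he⟩
  have c4 : (costF D (valuationOracle v) (b + 20) (.pair (.nat n) (.pair (encLab g)
      (.pair (.nat n) (encAdj G)))) : ℝ) ≤ 1000 * (n + 1) ^ 4 := by exact_mod_cast c2
  have c5 : (costF D (valuationOracle v) (b + 21) (.pair (.nat n) (.pair (.nat n) (encMap m))) : ℝ)
      ≤ 300 * (n + 1) ^ 3 := by exact_mod_cast c3
  have c6 := (Nat.cast_le (α := ℝ)).2 hz.2
  have c7 := (Nat.cast_le (α := ℝ)).2 hn.2
  push_cast at c6 c7
  have hN : (n + 1 : ℝ) ^ 3 ≤ (n + 1) ^ 4 := pow_le_pow_right₀ (by simp) (by omega)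
  have hN0 : (n + 1 : ℝ) ≤ (n + 1) ^ 4 := le_self_pow₀ (by simp) (by omega)
  have hN1 : (1 : ℝ) ≤ (n + 1) ^ 4 := one_le_pow₀ (by simp)
  simp [mainBody, evalT, evalV, encGraph_eq, hz.1, hn.1, v1, v2]
  linarith

end Output

/-! ### Running time -/

section RunningTime

/-- Number of nodes of the recursion tree over `r` nodes. -/
def treeSize (r : ℕ) : ℕ := if r = 0 then 1 else 4 * r - 1

/-- The offset `-1` pays for the root when both parts are non-empty; the slope `4` leaves room for
the leaves that stand for empty parts. -/
theorem treeSize_add {r r₁ r₂ : ℕ} (h : r₁ + r₂ ≤ r) (h1 : r₁ < r) (h2 : r₂ < r) :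
    1 + treeSize r₁ + treeSize r₂ ≤ treeSize r := by
  unfold treeSize
  split_ifs <;> omega

/-- Bound for the number of separator nodes above `r` open nodes. -/
noncomputable def boundarySize (L c α : ℝ) (r : ℕ) : ℝ := L * (r : ℝ) ^ c / (1 - α ^ c)

/-- Bound for the number of labels that are tried for a node. -/
noncomputable def branching (L c α : ℝ) (n : ℕ) : ℝ := (L / (1 - α ^ c) + 2) * (n : ℝ) ^ c

/-- Bound for the cost of one node of the recursion tree. -/
noncomputable def nodeCost (K E : ℝ) (n : ℕ) : ℝ := 3 * (5000 * (n + 1) ^ 3) + K * E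

/-- Bound for the number of steps of the search over `r` of `n` nodes. -/
noncomputable def searchCost (L c α K E : ℝ) (n r : ℕ) : ℝ :=
  nodeCost K E n * treeSize r * branching L c α n ^ (2 * boundarySize L c α r)

variable {L c α : ℝ}

theorem boundarySize_nonneg (hL : 0 < L) (hc : 0 < c) (hα0 : 0 ≤ α) (hα : α < 1) (r : ℕ) :
    0 ≤ boundarySize L c α r := by
  have := Real.rpow_lt_one hα0 hα hc
  have : 0 < 1 - α ^ c := by linarith
  unfold boundarySize
  positivity

/-- `L r^c / (1 - α^c)` is the solution of `B(r) = L r^c + B(α r)`, the sum of a geometric series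
with ratio `α^c`. -/
theorem boundarySize_add (hL : 0 < L) (hc : 0 < c) (hα0 : 0 ≤ α) (hα : α < 1) {r r₁ y : ℕ}
    (hy : (y : ℝ) ≤ L * (r : ℝ) ^ c) (hr : (r₁ : ℝ) ≤ α * r) :
    y + boundarySize L c α r₁ ≤ boundarySize L c α r := by
  have := Real.rpow_lt_one hα0 hα hc
  have h1 : 0 < 1 - α ^ c := by linarith
  have h2 : (r₁ : ℝ) ^ c ≤ α ^ c * (r : ℝ) ^ c := by
    rw [← Real.mul_rpow hα0 (Nat.cast_nonneg r)]
    exact Real.rpow_le_rpow (Nat.cast_nonneg _) hr hc.le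
  unfold boundarySize
  rw [← le_sub_iff_add_le, ← sub_div, le_div_iff₀ h1]
  have h3 := mul_le_mul_of_nonneg_right hy h1.le
  have h4 := mul_le_mul_of_nonneg_left h2 hL.le
  nlinarith

/-- The three demands on `Q`: to cover all labels in use and one more, to be at least `2` as
`branch_spec` needs, and to dominate the base `n^c` of the finder's running time. -/
theorem le_branching (hL : 0 < L) (hc : 0 < c) (hα0 : 0 ≤ α) (hα : α < 1) {n : ℕ} (hn : 0 < n) :
    boundarySize L c α n + 1 ≤ branching L c α n ∧ 2 ≤ branching L c α n ∧
      (n : ℝ) ^ c ≤ branching L c α n := by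
  have := Real.rpow_lt_one hα0 hα hc
  have h1 : 0 < 1 - α ^ c := by linarith
  have h2 : 1 ≤ (n : ℝ) ^ c := Real.one_le_rpow (by exact_mod_cast hn) hc.le
  have h3 : 0 ≤ L / (1 - α ^ c) := by positivity
  have h4 : 0 ≤ L / (1 - α ^ c) * (n : ℝ) ^ c := by positivity
  unfold boundarySize branching
  rw [mul_div_right_comm]
  refine ⟨?_, ?_, ?_⟩ <;> nlinarith

/-- The factor `2` in the exponent is there for the finder: `r^(2 c L r^c) = (r^c)^(2 L r^c) ≤ Q^(2
L r^c)`. The labels on the separator contribute only `Q^y`. All terms become multiples of the same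
power `q`, and what remains is the recurrence for `treeSize`. -/
theorem searchCost_step (hL : 0 < L) (hc : 0 < c) (hα0 : 0 ≤ α) (hα : α < 1) {K E τ : ℝ}
    (hK : 0 ≤ K) (hE : 0 ≤ E) {n r r₁ r₂ y : ℕ} (hr : 0 < r) (hrn : r ≤ n)
    (hτ : τ ≤ K * (E * (r : ℝ) ^ (2 * c * L * (r : ℝ) ^ c)))
    (hy : (y : ℝ) ≤ L * (r : ℝ) ^ c) (h1 : (r₁ : ℝ) ≤ α * r) (h2 : (r₂ : ℝ) ≤ α * r)
    (h12 : r₁ + r₂ + y ≤ r) :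
    τ + 5000 * (n + 1) ^ 3 + branching L c α n ^ y * (searchCost L c α K E n r₁ +
      searchCost L c α K E n r₂ + 2 * (5000 * (n + 1) ^ 3)) ≤ searchCost L c α K E n r := by
  have hn : 0 < n := by omega
  obtain ⟨-, hQ2, hQn⟩ := le_branching hL hc hα0 hα hn
  have hs0 := boundarySize_nonneg hL hc hα0 hα
  have ha1 := boundarySize_add hL hc hα0 hα hy h1
  have ha2 := boundarySize_add hL hc hα0 hα hy h2
  set Q := branching L c α n with hQdef
  have hQ1 : 1 ≤ Q := by linarith
  have hQ0 : 0 < Q := by linarith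
  have hrpos : (0 : ℝ) < r := by exact_mod_cast hr
  have hlt : ∀ {m : ℕ}, (m : ℝ) ≤ α * r → m < r := by
    intro m hm
    have : (m : ℝ) < r := by nlinarith
    exact_mod_cast this
  have htree : (1 + treeSize r₁ + treeSize r₂ : ℝ) ≤ treeSize r := by
    exact_mod_cast treeSize_add (by omega) (hlt h1) (hlt h2)
  set q := Q ^ (2 * boundarySize L c α r) with hq
  have hy0 : (0 : ℝ) ≤ y := Nat.cast_nonneg y
  have hq1 : 1 ≤ q := Real.one_le_rpow hQ1 (by linarith [hs0 r])
  have hmul : ∀ m, y + boundarySize L c α m ≤ boundarySize L c α r →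
      Q ^ y * Q ^ (2 * boundarySize L c α m) ≤ q := by
    intro m hm
    rw [← Real.rpow_natCast, ← Real.rpow_add hQ0]
    exact Real.rpow_le_rpow_of_exponent_le hQ1 (by linarith)
  have hQy : Q ^ y ≤ q := by
    rw [← Real.rpow_natCast]
    exact Real.rpow_le_rpow_of_exponent_le hQ1 (by linarith [hs0 r₁, hs0 r])
  have hτ' : τ ≤ K * E * q := by
    refine hτ.trans ?_
    rw [mul_assoc K E q]
    gcongr
    have e1 : (r : ℝ) ^ (2 * c * L * (r : ℝ) ^ c) = ((r : ℝ) ^ c) ^ (2 * (L * (r : ℝ) ^ c)) := by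
      rw [← Real.rpow_mul hrpos.le]
      ring_nf
    have e2 : L * (r : ℝ) ^ c ≤ boundarySize L c α r := by
      have h3 := Real.rpow_lt_one hα0 hα hc
      have h4 : 0 < 1 - α ^ c := by linarith
      have h5 : 0 ≤ α ^ c := Real.rpow_nonneg hα0 c
      unfold boundarySize
      rw [le_div_iff₀ h4]
      have : 0 ≤ L * (r : ℝ) ^ c := by positivity
      nlinarith
    rw [e1]
    calc ((r : ℝ) ^ c) ^ (2 * (L * (r : ℝ) ^ c)) ≤ Q ^ (2 * (L * (r : ℝ) ^ c)) := by
          refine Real.rpow_le_rpow (by positivity) (le_trans ?_ hQn) (by positivity)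
          exact Real.rpow_le_rpow hrpos.le (by exact_mod_cast hrn) hc.le
      _ ≤ q := Real.rpow_le_rpow_of_exponent_le hQ1 (by linarith)
  set N : ℝ := 5000 * (n + 1) ^ 3 with hN
  have hN0 : 0 ≤ N := by positivity
  have hX0 : 0 ≤ nodeCost K E n := by unfold nodeCost; positivity
  have hX : nodeCost K E n = 3 * N + K * E := rfl
  have g1 : Q ^ y * searchCost L c α K E n r₁ ≤ nodeCost K E n * treeSize r₁ * q := by
    unfold searchCost
    rw [mul_left_comm]
    exact mul_le_mul_of_nonneg_left (hmul _ ha1) (by positivity)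
  have g2 : Q ^ y * searchCost L c α K E n r₂ ≤ nodeCost K E n * treeSize r₂ * q := by
    unfold searchCost
    rw [mul_left_comm]
    exact mul_le_mul_of_nonneg_left (hmul _ ha2) (by positivity)
  have g3 : Q ^ y * (2 * N) ≤ q * (2 * N) := mul_le_mul_of_nonneg_right hQy (by positivity)
  have g4 : N ≤ q * N := le_mul_of_one_le_left hN0 hq1
  have g5 : nodeCost K E n * (1 + treeSize r₁ + treeSize r₂) * q ≤ searchCost L c α K E n r := by
    unfold searchCost
    exact mul_le_mul_of_nonneg_right (mul_le_mul_of_nonneg_left htree hX0) (by linarith)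
  -- One `N` from this node, two from the end of the branching, and `K * E` from the finder make up
  -- `nodeCost`.
  calc _ = τ + N + (Q ^ y * searchCost L c α K E n r₁ + Q ^ y * searchCost L c α K E n r₂ +
        Q ^ y * (2 * N)) := by ring
    _ ≤ K * E * q + q * N + (nodeCost K E n * treeSize r₁ * q + nodeCost K E n * treeSize r₂ * q +
        q * (2 * N)) := by gcongr
    _ = nodeCost K E n * (1 + treeSize r₁ + treeSize r₂) * q := by rw [hX]; ring
    _ ≤ _ := g5

theorem searchCost_zero (hL : 0 < L) (hc : 0 < c) (hα0 : 0 ≤ α) (hα : α < 1) {K E : ℝ}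
    (hK : 0 ≤ K) (hE : 0 ≤ E) {n : ℕ} (hn : 0 < n) :
    5000 * ((n : ℝ) + 1) ^ 3 ≤ searchCost L c α K E n 0 := by
  obtain ⟨-, hQ2, -⟩ := le_branching hL hc hα0 hα hn
  have h1 : 1 ≤ branching L c α n ^ (2 * boundarySize L c α 0) :=
    Real.one_le_rpow (by linarith) (by linarith [boundarySize_nonneg hL hc hα0 hα 0])
  have h2 : (5000 * ((n : ℝ) + 1) ^ 3) ≤ nodeCost K E n := by
    unfold nodeCost
    have : 0 ≤ (5000 * ((n : ℝ) + 1) ^ 3) := by positivity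
    have : 0 ≤ K * E := by positivity
    linarith
  have h3 : 0 ≤ nodeCost K E n := le_trans (by positivity) h2
  simp only [searchCost, treeSize, if_true, Nat.cast_one, mul_one]
  exact h2.trans (le_mul_of_one_le_right h3 h1)

/-- The whole computation over `n` nodes. -/
theorem totalCost_le (hL : 0 < L) (hc : 0 < c) (hα0 : 0 ≤ α) (hα : α < 1) {K E : ℝ}
    (hK : 0 ≤ K) (hE : 1 ≤ E) {n : ℕ} (hn : 0 < n) :
    searchCost L c α K E n n + 2000 * ((n : ℝ) + 1) ^ 4 ≤ (62000 + 4 * K) *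
      (((n : ℝ) + 1) ^ 4 * E * branching L c α n ^ (2 * boundarySize L c α n)) := by
  obtain ⟨-, hQ2, -⟩ := le_branching hL hc hα0 hα hn
  have h1 : 1 ≤ branching L c α n ^ (2 * boundarySize L c α n) :=
    Real.one_le_rpow (by linarith) (by linarith [boundarySize_nonneg hL hc hα0 hα n])
  unfold searchCost nodeCost
  set q := branching L c α n ^ (2 * boundarySize L c α n)
  have h2 : (treeSize n : ℝ) ≤ 4 * (n + 1) := by
    have : treeSize n ≤ 4 * (n + 1) := by unfold treeSize; split_ifs <;> omega
    exact_mod_cast this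
  set N : ℝ := n + 1 with hN
  have hN1 : 1 ≤ N := by simp [hN]
  have h3 : 3 * (5000 * N ^ 3) + K * E ≤ (15000 + K) * (N ^ 3 * E) := by
    have e1 : N ^ 3 ≤ N ^ 3 * E := le_mul_of_one_le_right (by positivity) hE
    have e2 : E ≤ N ^ 3 * E := le_mul_of_one_le_left (by positivity) (one_le_pow₀ hN1)
    nlinarith
  have h4 : N ^ 4 ≤ N ^ 4 * E * q := by
    rw [mul_assoc]
    exact le_mul_of_one_le_right (by positivity) (one_le_mul_of_one_le_of_one_le hE h1)
  calc _ ≤ (15000 + K) * (N ^ 3 * E) * (4 * N) * q + 2000 * (N ^ 4 * E * q) := by gcongr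
    _ = _ := by ring

end RunningTime

/-! ### Asymptotic comparison of the bounds -/

section Asymptotic

variable {L c α : ℝ}

/-- As `log Q = c log n + const`, the power of `Q` splits into a main term in `n^c log n` and a term
in `n^c`. -/
theorem cost_eq_exp (hL : 0 < L) (hc : 0 < c) (hα0 : 0 ≤ α) (hα : α < 1) (A : ℝ) {n : ℕ}
    (hn : 0 < n) :
    ((n : ℝ) + 1) ^ 4 * Real.exp A * branching L c α n ^ (2 * boundarySize L c α n) =
      Real.exp (4 * Real.log (n + 1) + A + 2 * L / (1 - α ^ c) *
        Real.log (L / (1 - α ^ c) + 2) * (n : ℝ) ^ c +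
          2 * L * c / (1 - α ^ c) * ((n : ℝ) ^ c * Real.log n)) := by
  have := Real.rpow_lt_one hα0 hα hc
  have h1 : 0 < 1 - α ^ c := by linarith
  have hn' : (0 : ℝ) < n := by exact_mod_cast hn
  have h3 : 0 < L / (1 - α ^ c) + 2 := by positivity
  have h4 : 0 < (n : ℝ) ^ c := by positivity
  have e1 : branching L c α n ^ (2 * boundarySize L c α n) =
      Real.exp ((Real.log (L / (1 - α ^ c) + 2) + c * Real.log n) *
        (2 * boundarySize L c α n)) := by
    rw [Real.rpow_def_of_pos (by unfold branching; positivity), branching,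
      Real.log_mul h3.ne' h4.ne', Real.log_rpow hn']
  have e2 : ((n : ℝ) + 1) ^ 4 = Real.exp (4 * Real.log (n + 1)) := by
    rw [mul_comm, Real.exp_mul, Real.exp_log (by positivity)]
    norm_cast
  rw [e1, e2, ← Real.exp_add, ← Real.exp_add, boundarySize]
  congr 1
  ring

theorem log_succ_le {n : ℕ} (hn : 2 ≤ n) : Real.log (n + 1) ≤ 2 * Real.log n := by
  have h : (2 : ℝ) ≤ n := by exact_mod_cast hn
  rw [show 2 * Real.log (n : ℝ) = Real.log ((n : ℝ) ^ 2) by simp]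
  exact Real.log_le_log (by positivity) (by nlinarith)

theorem eventually_log_le {r ε : ℝ} (hr : 0 < r) (hε : 0 < ε) :
    ∀ᶠ n : ℕ in atTop, Real.log n ≤ ε * (n : ℝ) ^ r := by
  have h := ((isLittleO_log_rpow_atTop hr).comp_tendsto tendsto_natCast_atTop_atTop).bound hε
  filter_upwards [h, eventually_ge_atTop 1] with n hn h1
  have h2 : (1 : ℝ) ≤ n := by exact_mod_cast h1
  have h3 := Real.rpow_nonneg (zero_le_one.trans h2) r
  simpa [abs_of_nonneg (Real.log_nonneg h2), abs_of_nonneg h3] using hn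

theorem eventually_le_log (x : ℝ) : ∀ᶠ n : ℕ in atTop, x ≤ Real.log n :=
  (Real.tendsto_log_atTop.comp tendsto_natCast_atTop_atTop).eventually_ge_atTop x

theorem cost_isBigO_of_le_one (hL : 0 < L) (hc : 0 < c) (hα0 : 0 ≤ α) (hα : α < 1) {A b γ : ℝ}
    (hA : 0 ≤ A) (hb : b ≤ 1) (hγ : 2 * L * c / (1 - α ^ c) < γ) :
    (fun n : ℕ => ((n : ℝ) + 1) ^ 4 * Real.exp (A * (n : ℝ) ^ (b * c)) *
      branching L c α n ^ (2 * boundarySize L c α n)) =O[atTop]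
        fun n : ℕ => (n : ℝ) ^ (γ * (n : ℝ) ^ c) := by
  refine IsBigO.of_bound 1 ?_
  set C := 2 * L / (1 - α ^ c) * Real.log (L / (1 - α ^ c) + 2)
  set γ₀ := 2 * L * c / (1 - α ^ c)
  -- For `n ≥ 2`, `4 log (n + 1) ≤ 8 log n`, and eventually `log n ≤ n^c`. So everything except `γ₀
  -- n^c log n` is at most `(8 + A + C) n^c`, which the surplus `γ - γ₀` absorbs once `log n` is
  -- large.
  filter_upwards [eventually_ge_atTop 2, eventually_log_le hc zero_lt_one,
    eventually_le_log ((8 + A + C) / (γ - γ₀))] with n hn h1 h2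
  have hn' : (2 : ℝ) ≤ n := by exact_mod_cast hn
  rw [cost_eq_exp hL hc hα0 hα _ (by omega : 0 < n),
    Real.rpow_def_of_pos (by linarith) (γ * (n : ℝ) ^ c), Real.norm_eq_abs, Real.norm_eq_abs,
    Real.abs_exp, Real.abs_exp, one_mul, Real.exp_le_exp]
  have h3 := log_succ_le hn
  have h4 : (n : ℝ) ^ (b * c) ≤ (n : ℝ) ^ c :=
    Real.rpow_le_rpow_of_exponent_le (by linarith) (by nlinarith)
  rw [div_le_iff₀ (by linarith)] at h2
  have h5 : 0 ≤ (n : ℝ) ^ c := by positivity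
  have h6 := mul_le_mul_of_nonneg_left h2 h5
  have h7 := mul_le_mul_of_nonneg_left h4 hA
  nlinarith

theorem cost_isBigO_of_one_lt (hL : 0 < L) (hc : 0 < c) (hα0 : 0 ≤ α) (hα : α < 1) {A b γ : ℝ}
    (hb : 1 < b) (hγ : A < γ) :
    (fun n : ℕ => ((n : ℝ) + 1) ^ 4 * Real.exp (A * (n : ℝ) ^ (b * c)) *
      branching L c α n ^ (2 * boundarySize L c α n)) =O[atTop]
        fun n : ℕ => Real.exp (γ * (n : ℝ) ^ (b * c)) := by
  refine IsBigO.of_bound 1 ?_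
  set C := 2 * L / (1 - α ^ c) * Real.log (L / (1 - α ^ c) + 2)
  set γ₀ := 2 * L * c / (1 - α ^ c)
  have hbc : 0 < b * c - c := by nlinarith
  -- All terms other than `A n^(bc)` are at most `B n^c log n`, and `log n` is eventually below any
  -- multiple of `n^(bc - c)`.
  set B := 8 + |C| + |γ₀|
  have hB : 0 < B := by positivity
  filter_upwards [eventually_ge_atTop 2, eventually_log_le hbc (div_pos (sub_pos.2 hγ) hB),
    eventually_le_log 1] with n hn h1 h2
  have hn' : (2 : ℝ) ≤ n := by exact_mod_cast hn
  rw [cost_eq_exp hL hc hα0 hα _ (by omega : 0 < n),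
    Real.norm_eq_abs, Real.norm_eq_abs, Real.abs_exp, Real.abs_exp, one_mul, Real.exp_le_exp]
  have h3 := log_succ_le hn
  have h5 : 1 ≤ (n : ℝ) ^ c := Real.one_le_rpow (by linarith) hc.le
  have h6 : B * ((n : ℝ) ^ c * Real.log n) ≤ (γ - A) * (n : ℝ) ^ (b * c) := by
    have e : (n : ℝ) ^ (b * c) = (n : ℝ) ^ c * (n : ℝ) ^ (b * c - c) := by
      rw [← Real.rpow_add (by linarith)]
      ring_nf
    rw [e]
    calc _ ≤ B * ((n : ℝ) ^ c * ((γ - A) / B * (n : ℝ) ^ (b * c - c))) := by gcongr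
      _ = _ := by field_simp
  set z := (n : ℝ) ^ c * Real.log n
  have h7 : Real.log n ≤ z := le_mul_of_one_le_left (by linarith) h5
  have h8 : (n : ℝ) ^ c ≤ z := le_mul_of_one_le_right (by linarith) h2
  have h9 : C * (n : ℝ) ^ c ≤ |C| * z :=
    (mul_le_mul_of_nonneg_right (le_abs_self C) (by linarith)).trans
      (mul_le_mul_of_nonneg_left h8 (abs_nonneg C))
  have h10 : γ₀ * z ≤ |γ₀| * z := mul_le_mul_of_nonneg_right (le_abs_self γ₀) (by linarith)
  have h11 : B * z = 8 * z + |C| * z + |γ₀| * z := by ring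
  linarith

end Asymptotic

/-! ### Assembling the program and the theorem -/

section Main

theorem contains_solver (p : Program) :
    Contains (solver p).defs p.defs.length p.main := by
  intro i _
  simp [solver, List.getElem?_append_right]

theorem solvedInBigO_of_forall_notMem {S : GraphClass} (h : ∀ n, 0 < n → ∀ G, G ∉ S n)
    (T : ℕ → ℝ) : SolvedInBigO S T := by
  refine ⟨⟨[], .lit 0⟩, 0, by simpa using isBigO_zero T atTop, ?_⟩
  intro n G hG hconn
  obtain ⟨i⟩ := hconn.nonempty
  exact absurd hG (h n (Fin.pos i) G)

theorem solvedInBigO {S : GraphClass} (hS : SubgraphClosed S) {L c α A b : ℝ}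
    (hL : 0 < L) (hc : 0 < c) (hα0 : 0 ≤ α) (hα : α < 1) (hA : 0 ≤ A) (hb : 0 < b)
    (hfind : SeparatorFoundInLittleO S (fun n => L * (n : ℝ) ^ c) α fun n =>
      Real.exp (A * (n : ℝ) ^ (b * c)) * (n : ℝ) ^ (2 * c * L * (n : ℝ) ^ c)) {T : ℕ → ℝ}
    (hT : (fun n : ℕ => ((n : ℝ) + 1) ^ 4 * Real.exp (A * (n : ℝ) ^ (b * c)) *
      branching L c α n ^ (2 * boundarySize L c α n)) =O[atTop] T) : SolvedInBigO S T := by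
  obtain ⟨p, t, ht, hp⟩ := hfind
  -- The finder is also called on small subgraphs, so the asymptotic bound is turned into one for
  -- every size at which the comparison function is non-zero.
  obtain ⟨K, hK, hKt⟩ := bound_of_isBigO_nat_atTop ht.isBigO
  set W : ℕ → ℝ := fun n => (62000 + 4 * K) * (((n : ℝ) + 1) ^ 4 *
    Real.exp (A * (n : ℝ) ^ (b * c)) * branching L c α n ^ (2 * boundarySize L c α n)) with hW
  refine ⟨solver p, fun n => ⌊W n⌋₊, ?_, ?_⟩
  · refine IsBigO.trans (IsBigO.of_bound 1 ?_) (hT.const_mul_left (62000 + 4 * K))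
    filter_upwards [eventually_gt_atTop 0] with n hn
    have h1 : 0 ≤ branching L c α n := by linarith [(le_branching hL hc hα0 hα hn).2.1]
    have h2 : 0 ≤ W n := by simp only [hW]; positivity
    rw [Real.norm_of_nonneg (Nat.cast_nonneg _), one_mul]
    exact (Nat.floor_le h2).trans (le_abs_self _)
  · intro n G hG hconn v h0 hv
    obtain ⟨i⟩ := hconn.nonempty
    have hn : 0 < n := Fin.pos i
    have ho := valuationOracle_det v
    have hD := contains_solver p
    obtain ⟨hQ1, hQ2, -⟩ := le_branching hL hc hα0 hα hn
    set E := Real.exp (A * (n : ℝ) ^ (b * c)) with hE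
    have hE0 : 0 ≤ E := (Real.exp_pos _).le
    have hE1 : 1 ≤ E := Real.one_le_exp (by positivity)
    have hτ : ∀ r : ℕ, 0 < r → r ≤ n →
        (t r : ℝ) ≤ K * (E * (r : ℝ) ^ (2 * c * L * (r : ℝ) ^ c)) := by
      intro r hr hrn
      have hr' : (0 : ℝ) < r := by exact_mod_cast hr
      have h1 : 0 < Real.exp (A * (r : ℝ) ^ (b * c)) * (r : ℝ) ^ (2 * c * L * (r : ℝ) ^ c) := by
        positivity
      have h2 := hKt h1.ne'
      rw [Real.norm_of_nonneg (Nat.cast_nonneg _), Real.norm_of_nonneg h1.le] at h2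
      refine h2.trans ?_
      gcongr
      exact Real.exp_le_exp.2 (mul_le_mul_of_nonneg_left
        (Real.rpow_le_rpow hr'.le (by exact_mod_cast hrn) (by positivity)) hA)
    -- With `M = boundarySize L c α n` the number of labels allowed at the root is `M - σ n = 0`.
    have hs := solve_spec (G := G) (v := v) (M := boundarySize L c α n)
      (Q := branching L c α n) hD hv hQ1 hQ2 hα (fun r => L * (r : ℝ) ^ c) (fun r => t r)
      (searchCost L c α K E n) (boundarySize L c α)
      (by
        intro l hl hne
        -- Closure under subgraphs keeps every induced subgraph of the recursion in the class, so
        -- the finder applies to it.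
        have hH : G.comap l.get ∈ S l.length := hS _ _ _ _ (List.length_pos_of_ne_nil hne) hG
          ⟨(SimpleGraph.Embedding.comap ⟨l.get, List.nodup_iff_injective_get.1 hl⟩ G).toCopy⟩
        obtain ⟨X, Y, k, hk, hXY, hrun⟩ := hp _ _ (List.length_pos_of_ne_nil hne) hH
        -- The finder's functions come first in `solver p` and keep their numbers, and a run without
        -- oracle makes no query.
        have hrun' := Steps.mono (D' := (solver p).defs) (orc' := valuationOracle v)
          (fun f body hf => by
            have : f < p.defs.length := (List.getElem?_eq_some_iff.1 hf).1
            rw [← hf, solver, List.getElem?_append_left this])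
          (fun x r h => h.elim) hrun
        obtain ⟨e1, e2⟩ := valF_costF_of_steps (f := p.defs.length) ho
          (by simpa [functions] using hD 0 (by omega)) hrun'
        exact ⟨X, Y, hXY, e1, by rw [e2]; exact_mod_cast hk⟩)
      (searchCost_zero hL hc hα0 hα hK.le hE0 hn)
      (fun r r₁ r₂ y hr hrn hy h1 h2 h12 =>
        searchCost_step hL hc hα0 hα hK.le hE0 hr hrn (hτ r hr hrn) hy h1 h2 h12)
      (boundarySize_nonneg hL hc hα0 hα)
      (fun r r₁ y _ hy h1 => boundarySize_add hL hc hα0 hα hy h1)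
      n (nodesBelow n n) (nodup_nodesBelow n)
      (by
        rw [← List.toFinset_card_of_nodup (nodup_nodesBelow n),
          show (nodesBelow n n).toFinset = Finset.univ by ext i; simp [mem_nodesBelow]]
        simp)
    obtain ⟨P, y, k, hk, hP, hy, hrun⟩ := main_spec hD hv h0 (sub_self _).ge hs
    refine ⟨P, y, k, Nat.le_floor (hk.trans ?_), hP, hy, hrun⟩
    exact totalCost_le hL hc hα0 hα hK.le hE1 hn

end Main

end GCSG

theorem proposition1 (S : GCSG.GraphClass) (hS : GCSG.SubgraphClosed S)
    (K a b : ℝ) (hK : 0 < K) (ha : 0 < a) (hb : 0 < b)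
    (hcount : GCSG.ConnectedCSBound S fun n => K * Real.exp (a * (n : ℝ) ^ b))
    (L c α : ℝ) (hL : 0 < L) (hc : 0 < c) (hα : α < 1)
    (hsep : GCSG.SeparatorTheorem S (fun n => L * (n : ℝ) ^ c) α)
    (hfind : GCSG.SeparatorFoundInLittleO S (fun n => L * (n : ℝ) ^ c) α fun n =>
      Real.exp (2 * a * L ^ b * (n : ℝ) ^ (b * c)) * (n : ℝ) ^ (2 * c * L * (n : ℝ) ^ c)) :
    (b ≤ 1 → ∀ γ : ℝ, 2 * L * c / (1 - α ^ c) < γ →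
      GCSG.SolvedInBigO S fun n => (n : ℝ) ^ (γ * (n : ℝ) ^ c)) ∧
    (1 < b → ∀ γ : ℝ, 2 * a * L ^ b / (1 - α ^ (b * c)) < γ →
      GCSG.SolvedInBigO S fun n => Real.exp (γ * (n : ℝ) ^ (b * c))) := by
  rcases lt_or_ge α 0 with hα0 | hα0
  -- A negative `α` would bound the size of `A \ B` by a negative number, so the class has no graph
  -- with a node.
  · have hempty : ∀ n, 0 < n → ∀ G, G ∉ S n := by
      intro n hn G hG
      obtain ⟨A, B, -, -, h, -⟩ := hsep n G hn hG
      have h1 : (0 : ℝ) < n := by exact_mod_cast hn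
      have h2 : (0 : ℝ) ≤ (A.verts \ B.verts).ncard := Nat.cast_nonneg _
      rw [Fintype.card_fin] at h
      nlinarith
    exact ⟨fun _ _ _ => GCSG.solvedInBigO_of_forall_notMem hempty _,
      fun _ _ _ => GCSG.solvedInBigO_of_forall_notMem hempty _⟩
  · have hA : 0 ≤ 2 * a * L ^ b := by positivity
    refine ⟨fun hb1 γ hγ => GCSG.solvedInBigO hS hL hc hα0 hα hA hb hfind
      (GCSG.cost_isBigO_of_le_one hL hc hα0 hα hA hb1 hγ), fun hb1 γ hγ =>
      GCSG.solvedInBigO hS hL hc hα0 hα hA hb hfind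
        (GCSG.cost_isBigO_of_one_lt hL hc hα0 hα hb1 (lt_of_le_of_lt ?_ hγ))⟩
    -- Since `0 ≤ α^(bc) < 1`, dividing `2 a L^b` by `1 - α^(bc)` can only enlarge it.
    have h1 : α ^ (b * c) < 1 := Real.rpow_lt_one hα0 hα (by positivity)
    have h2 : 0 ≤ α ^ (b * c) := Real.rpow_nonneg hα0 _
    rw [le_div_iff₀ (by linarith)]
    nlinarith
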